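/- Let $\vartheta(z|\tau)=\sum_{n\in\mathbb Z}e^{2\pi i nz+i\pi n^2\tau}$ and $\vartheta_{11}(z|\tau)=i\,e^{i\pi(z+\tau/4)}\,\vartheta\bigl(z+\tfrac{1+\tau}{2}\big|\tau\bigr)$ for $z\in\mathbb C$, $\operatorname{Im}\tau>0$, and write $\vartheta_{11}'$ for the derivative in $z$. For $\eta>0$ put $$x_*=-\frac{2(1-e^{-\eta})}{\eta},\qquad \mathcal U(K)=2K\,e^{\frac{\eta}{2}\left(\frac{\eta}{2K}-1\right)}\,\frac{\vartheta_{11}\bigl(\frac{\eta}{2K}\big|\frac{i\pi}{K}\bigr)}{\vartheta_{11}'\bigl(0\big|\frac{i\pi}{K}\bigr)}\qquad(K>\eta/2).$$ For $x\in(x_*,2)$ let $\mathcal K(x)$ be the solution $K\in(\eta/2,\infty)$ of $\mathcal U(K)-K\,\mathcal U'(K)=-\tfrac{\eta x}{2}$, let $$\mathcal L(x)=-\frac{\frac{\eta x}{2}+\mathcal U(\mathcal K(x))}{\mathcal K(x)},$$ and define the rate function $\mathcal F:\mathbb R\to\mathbb R$ by $$\mathcal F(x)=\begin{cases}\frac{\eta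 x^2}{2}+1-e^{-\eta}, & x\le x_*,\\[2pt] \frac{\eta x^2}{2}+1-e^{-\eta}+\eta\int_{x_*}^x\mathcal L(y)\,dy, & x_*<x<2,\\[2pt] 0,& x\ge 2.\end{cases}$$ **Theorem.** For every $\eta>0$ these objects are well defined (for every $x\in(x_*,2)$ the solution $\mathcal K(x)$ exists and is unique, and $\mathcal L$ is integrable on $(x_*,x)$), and $\mathcal F\in C^2(\mathbb R)\setminus C^3(\mathbb R)$. Moreover: 1. As $x\uparrow 2$, $\mathcal F(x)=\frac{1}{12}(2-x)^3+O\bigl((2-x)^4\bigr)$. 2. $\mathcal F''$ is not Hölder continuous at $x_*$ for any Hölder exponent: for every $\alpha>0$ there are no constant $C$ and neighbourhood of $x_*$ on which $|\mathcal F''(x)-\mathcal F''(x_*)|\le C|x-x_*|^{\alpha}$. -/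

import Mathlib

open Real Set Filter Topology Asymptotics

namespace PhaseTransition

noncomputable section

/-- The odd elliptic theta function `ϑ₁₁(z | τ) = i e^{iπ(z + τ/4)} ϑ(z + (1 + τ)/2 | τ)`.
Here `ϑ(z | τ) = ∑_{n ∈ ℤ} exp(2πi n z + iπ n² τ)` is Mathlib's `jacobiTheta₂ z τ`. -/
def theta11 (z τ : ℂ) : ℂ :=
  Complex.I * Complex.exp (Complex.I * π * (z + τ / 4)) * jacobiTheta₂ (z + (1 + τ) / 2) τ

/-- The ratio `ϑ₁₁(η/(2K) | iπ/K) / ϑ₁₁'(0 | iπ/K)`, the prime being the derivative in the first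
argument. It is a real number for real `η`, `K`; see `theta11Ratio_im`. -/
def theta11Ratio (η K : ℝ) : ℂ :=
  theta11 ((η / (2 * K) : ℝ) : ℂ) (Complex.I * π / K) /
    deriv (fun z : ℂ => theta11 z (Complex.I * π / K)) 0

/-- `𝒰(K) = 2K e^{(η/2)(η/(2K) - 1)} ϑ₁₁(η/(2K) | iπ/K) / ϑ₁₁'(0 | iπ/K)`, used for `K > η/2`. -/
def calU (η K : ℝ) : ℝ :=
  2 * K * Real.exp (η / 2 * (η / (2 * K) - 1)) * (theta11Ratio η K).re

/-- The critical point `x_* = -2 (1 - e^{-η}) / η`. -/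
def xStar (η : ℝ) : ℝ := -2 * (1 - Real.exp (-η)) / η

/-- `K` lies in `(η/2, ∞)` and solves `(1 - K ∂/∂K) 𝒰(K) = -η x / 2`. -/
def IsHalfPeriod (η x K : ℝ) : Prop :=
  η / 2 < K ∧ calU η K - K * deriv (calU η) K = -(η * x / 2)

/-- The implicit half-period: for `x ∈ (x_*, 2)`, the solution `K` of `IsHalfPeriod η x K`. -/
def calK (η x : ℝ) : ℝ := Classical.epsilon (IsHalfPeriod η x)

/-- `ℒ(x) = -(η x / 2 + 𝒰(𝒦(x))) / 𝒦(x)`, for `x ∈ (x_*, 2)`. -/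
def calL (η x : ℝ) : ℝ := -(η * x / 2 + calU η (calK η x)) / calK η x

/-- The rate function `ℱ`. -/
def rateFunction (η x : ℝ) : ℝ :=
  if x ≤ xStar η then η * x ^ 2 / 2 + 1 - Real.exp (-η)
  else if x < 2 then
    η * x ^ 2 / 2 + 1 - Real.exp (-η) + η * ∫ y in (xStar η)..x, calL η y
  else 0

theorem theta11_conj (z τ : ℂ) :
    (starRingEnd ℂ) (theta11 z τ) =
      theta11 ((starRingEnd ℂ) z) (-(starRingEnd ℂ) τ) := by
  set w := (starRingEnd ℂ) z
  set s := -(starRingEnd ℂ) τ with hs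
  have hs' : (starRingEnd ℂ) τ = -s := by simp [hs]
  have h1 : jacobiTheta₂ (w + (1 + s) / 2) s =
      Complex.exp (-π * Complex.I * (s + 2 * (w + (1 - s) / 2))) *
        jacobiTheta₂ (w + (1 - s) / 2) s := by
    rw [← jacobiTheta₂_add_left']
    congr 1
    ring
  have h2 : (starRingEnd ℂ) (jacobiTheta₂ (z + (1 + τ) / 2) τ) =
      jacobiTheta₂ (w + (1 - s) / 2) s := by
    rw [jacobiTheta₂_conj]
    congr 1
    simp only [map_add, map_div₀, map_one, map_ofNat, hs']
    ring
  unfold theta11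
  rw [map_mul, map_mul, h2, h1, ← Complex.exp_conj]
  simp only [map_mul, map_add, map_div₀, map_ofNat, Complex.conj_I, Complex.conj_ofReal, hs']
  rw [show -Complex.I * (π : ℂ) * ((starRingEnd ℂ) z + -s / 4) =
      Complex.I * π * (w + s / 4) + -π * Complex.I * (s + 2 * (w + (1 - s) / 2))
        + π * Complex.I by simp only [w]; ring, Complex.exp_add, Complex.exp_add,
    Complex.exp_pi_mul_I]
  ring

/-- The theta quotient in the definition of `𝒰` is real, so no information is lost by `re`. -/
theorem theta11Ratio_im (η K : ℝ) : (theta11Ratio η K).im = 0 := by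
  rw [← Complex.conj_eq_iff_im]
  have hτ : -(starRingEnd ℂ) (Complex.I * π / K) = Complex.I * π / K := by
    simp [neg_div]
  have hd : (starRingEnd ℂ) (deriv (fun z : ℂ => theta11 z (Complex.I * π / K)) 0) =
      deriv (fun z : ℂ => theta11 z (Complex.I * π / K)) 0 := by
    have h := congrFun (deriv_conj_conj (f := fun z : ℂ => theta11 z (Complex.I * π / K))) 0
    have hf : (starRingEnd ℂ) ∘ (fun z : ℂ => theta11 z (Complex.I * π / K)) ∘ (starRingEnd ℂ) =
        fun z : ℂ => theta11 z (Complex.I * π / K) := by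
      funext z
      simp only [Function.comp_apply]
      rw [theta11_conj, hτ, Complex.conj_conj]
    rw [hf] at h
    simpa using h.symm
  unfold theta11Ratio
  rw [map_div₀, hd, theta11_conj, hτ, Complex.conj_ofReal]

end

end PhaseTransition

/-!
For `K > 0` Jacobi's imaginary transformation turns the theta quotient in `𝒰` into a quotient of the
real series `T_j(u, K) = ∑ (-1)ⁿ (n + 1/2)ʲ exp (-K (n + 1/2)² + (n + 1/2) u)` (`thetaSeries`):
`𝒰(K) = exp (-η / 2) T₀(η, K) / T₁(0, K)` (`calU_eq_thetaSeries`). The series satisfy the heat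
equation `∂_K T_j = -T_{j+2}`, so every `K`-derivative of `𝒰` is explicit, and quasi-periodicity in
`u` gives `𝒰 = 0`, `𝒰' = 2`, `𝒰'' = -4` at `K = η / 2` (`calU_half`).

*Concavity.* By a finite form of the Jacobi triple product,
`𝒰(K) = (1 - exp (-η)) ∏ (1 - sinh² (η / 2) / sinh² (n K))` over `n ≥ 1` (`tendsto_sinhProd`). Write
`g n` for the logarithmic derivative of the `n`-th factor. For `η < 2 K` the sum of the `g n` with
`n ≥ 2` is dominated by its value at `η = 2 K`, where it telescopes
(`sum_sinhFactorLog_le`); this is just what is needed for the second derivative of the first factor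
to beat all cross terms, whence `𝒰'' < 0` on `(η / 2, ∞)` (`calU₂_neg`).

*Parametrisation.* The equation for `𝒦(x)` reads `x = X(K)` with `X = (2 / η) (K 𝒰' - 𝒰)` (`calX`)
and `X' = (2 / η) K 𝒰'' < 0`. So `X` is a decreasing bijection of `(η / 2, ∞)` onto `(x_*, 2)`, and
`ℒ(x) = -𝒰'(𝒦(x))` has derivative `-η / (2 𝒦(x))`. Between the transition points the second
derivative of the rate function is therefore `η (1 - η / (2 𝒦(x)))`, which tends to `η` at `x_*` and
to `0` at `2`.

*Matching at `2`.* That the rate function itself tends to `0` at `2` amounts to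
`∫ 𝒰'² dK = 1 - exp (-η)` over `(η / 2, ∞)`. An explicit antiderivative of `𝒰'²` (`energy`) exists
thanks to the bilinear identity `thetaSeries_hirota`, the form taken here by the differential
equation of the Weierstrass function; it expresses that three second order theta functions in a
space spanned by two of them are linearly dependent.

*Transition points.* Near `2`, `X(K) = 2 - 4 (K - η / 2) + O((K - η / 2)²)` makes the second
derivative `(2 - x) / 2 + O((2 - x)²)`, which is integrated twice. Near `x_*`, `X(K) - x_*` is
exponentially small in `K` while the second derivative differs from `η` by `η² / (2 K)`, so no
Hölder bound holds; in particular the rate function is not `C³`.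
-/

namespace PhaseTransition

/-! ### The real theta series -/

/-- The `n`-th term of the `j`-th `u`-derivative of the theta series
`∑ (-1)ⁿ exp (-K (n + 1/2)² + (n + 1/2) u)`. -/
noncomputable def thetaTerm (j : ℕ) (u K : ℝ) (n : ℤ) : ℝ :=
  (-1) ^ n * ((n : ℝ) + 1 / 2) ^ j * Real.exp (-K * ((n : ℝ) + 1 / 2) ^ 2 + ((n : ℝ) + 1 / 2) * u)

/-- The `j`-th `u`-derivative of the odd theta function
`∑ (-1)ⁿ exp (-K (n + 1/2)² + (n + 1/2) u)`, which is `ϑ₁₁` after the Jacobi imaginary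
transformation, in real variables. -/
noncomputable def thetaSeries (j : ℕ) (u K : ℝ) : ℝ := ∑' n : ℤ, thetaTerm j u K n

/-- A majorant of `thetaTerm j u K` for `|u| ≤ R` and `K ≥ k`. -/
noncomputable def thetaBound (j : ℕ) (R k : ℝ) (n : ℤ) : ℝ :=
  |(n : ℝ) + 1 / 2| ^ j * Real.exp (-k * ((n : ℝ) + 1 / 2) ^ 2 + |(n : ℝ) + 1 / 2| * R)

theorem abs_thetaTerm (j : ℕ) (u K : ℝ) (n : ℤ) :
    |thetaTerm j u K n| =
      |(n : ℝ) + 1 / 2| ^ j *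
        Real.exp (-K * ((n : ℝ) + 1 / 2) ^ 2 + ((n : ℝ) + 1 / 2) * u) := by
  unfold thetaTerm
  rw [abs_mul, abs_mul, abs_pow, Real.abs_exp, abs_zpow, abs_neg, abs_one, one_zpow, one_mul]

theorem abs_thetaTerm_le {R k u K : ℝ} (hu : |u| ≤ R) (hK : k ≤ K) (j : ℕ) (n : ℤ) :
    |thetaTerm j u K n| ≤ thetaBound j R k n := by
  rw [abs_thetaTerm]
  unfold thetaBound
  refine mul_le_mul_of_nonneg_left (Real.exp_le_exp.mpr (add_le_add ?_ ?_)) (by positivity)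
  · exact mul_le_mul_of_nonneg_right (neg_le_neg hK) (sq_nonneg _)
  calc ((n : ℝ) + 1 / 2) * u ≤ |((n : ℝ) + 1 / 2) * u| := le_abs_self _
    _ = |(n : ℝ) + 1 / 2| * |u| := abs_mul _ _
    _ ≤ |(n : ℝ) + 1 / 2| * R := by gcongr

theorem summable_thetaBound (j : ℕ) {R k : ℝ} (hR : 0 ≤ R) (hk : 0 < k) :
    Summable (thetaBound j R k) := by
  have h (i : ℕ) := summable_pow_mul_jacobiTheta₂_term_bound ((k + R) / (2 * π))
    (div_pos hk Real.pi_pos) i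
  have h2 := ((h j).add (h 0)).mul_left (2 ^ j * Real.exp R)
  refine Summable.of_nonneg_of_le (fun n => by unfold thetaBound; positivity) (fun n => ?_) h2
  have hπ := Real.pi_pos
  have e : -π * (k / π * (n : ℝ) ^ 2 - 2 * ((k + R) / (2 * π)) * ((|n| : ℤ) : ℝ)) =
      -k * (n : ℝ) ^ 2 + (k + R) * |(n : ℝ)| := by
    push_cast
    field_simp
    ring
  simp only [e]
  rw [show ∀ a b c d : ℝ, a * b * (c * d + ((|n| : ℤ) : ℝ) ^ 0 * d) = (a * (c + 1)) * (b * d) by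
    intros; rw [pow_zero]; ring, ← Real.exp_add]
  have h1 : |(n : ℝ) + 1 / 2| ≤ |(n : ℝ)| + 1 := (abs_add_le _ _).trans (by norm_num)
  unfold thetaBound
  push_cast
  apply mul_le_mul _ _ (Real.exp_pos _).le (by positivity)
  · calc |(n : ℝ) + 1 / 2| ^ j ≤ (|(n : ℝ)| + 1) ^ j := by gcongr
      _ ≤ 2 ^ (j - 1) * (|(n : ℝ)| ^ j + 1 ^ j) := add_pow_le (abs_nonneg _) zero_le_one j
      _ ≤ 2 ^ j * (|(n : ℝ)| ^ j + 1) := by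
        rw [one_pow]
        gcongr
        · norm_num
        · omega
  · apply Real.exp_le_exp.mpr
    have h3 : |(n : ℝ) + 1 / 2| * R ≤ (|(n : ℝ)| + 1) * R := by gcongr
    have h4 : -(n : ℝ) ≤ |(n : ℝ)| := neg_le_abs _
    nlinarith

theorem summable_thetaTerm (j : ℕ) (u : ℝ) {K : ℝ} (hK : 0 < K) : Summable (thetaTerm j u K) :=
  Summable.of_norm_bounded (summable_thetaBound j (abs_nonneg u) hK)
    (fun n => abs_thetaTerm_le le_rfl le_rfl j n)

theorem hasSum_thetaTerm (j : ℕ) (u : ℝ) {K : ℝ} (hK : 0 < K) :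
    HasSum (thetaTerm j u K) (thetaSeries j u K) :=
  (summable_thetaTerm j u hK).hasSum

theorem hasDerivAt_thetaSeries_left (j : ℕ) (u : ℝ) {K : ℝ} (hK : 0 < K) :
    HasDerivAt (fun v => thetaSeries j v K) (thetaSeries (j + 1) u K) u := by
  refine hasDerivAt_tsum_of_isPreconnected (t := Ioo (-(|u| + 1)) (|u| + 1))
    (g := fun n v => thetaTerm j v K n) (g' := fun n v => thetaTerm (j + 1) v K n)
    (summable_thetaBound (j + 1) (R := |u| + 1) (by positivity) hK) isOpen_Ioo
    isPreconnected_Ioo (fun n v _ => ?_) (fun n v hv => ?_) (y₀ := u) ?_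
    (summable_thetaTerm j u hK) ?_
  · have h : HasDerivAt (fun v : ℝ => -K * ((n : ℝ) + 1 / 2) ^ 2 + ((n : ℝ) + 1 / 2) * v)
        ((n : ℝ) + 1 / 2) v := by
      simpa using ((hasDerivAt_id v).const_mul ((n : ℝ) + 1 / 2)).const_add
        (-K * ((n : ℝ) + 1 / 2) ^ 2)
    refine (h.exp.const_mul ((-1 : ℝ) ^ n * ((n : ℝ) + 1 / 2) ^ j)).congr_deriv ?_
    simp only [thetaTerm]
    ring
  · exact abs_thetaTerm_le (abs_lt.mpr hv).le le_rfl _ _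
  all_goals exact abs_lt.mp (lt_add_one _)

/-- The heat equation, for each derivative of the theta series. -/
theorem hasDerivAt_thetaSeries_right (j : ℕ) (u : ℝ) {K : ℝ} (hK : 0 < K) :
    HasDerivAt (fun k => thetaSeries j u k) (-thetaSeries (j + 2) u K) K := by
  have := hasDerivAt_tsum_of_isPreconnected (t := Ioi (K / 2)) (𝕜 := ℝ)
    (g := fun n k => thetaTerm j u k n) (g' := fun n k => -thetaTerm (j + 2) u k n)
    (u := thetaBound (j + 2) (|u|) (K / 2)) (y := K)
    (summable_thetaBound (j + 2) (abs_nonneg u) (half_pos hK)) isOpen_Ioi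
    isPreconnected_Ioi (fun n k _ => ?_) (fun n k hk => ?_) (y₀ := K) ?_
    (summable_thetaTerm j u hK) ?_
  · rw [tsum_neg] at this
    exact this
  · have h : HasDerivAt (fun k : ℝ => -k * ((n : ℝ) + 1 / 2) ^ 2 + ((n : ℝ) + 1 / 2) * u)
        (-((n : ℝ) + 1 / 2) ^ 2) k := by
      simpa using ((hasDerivAt_id k).neg.mul_const (((n : ℝ) + 1 / 2) ^ 2)).add_const
        (((n : ℝ) + 1 / 2) * u)
    refine (h.exp.const_mul ((-1 : ℝ) ^ n * ((n : ℝ) + 1 / 2) ^ j)).congr_deriv ?_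
    simp only [thetaTerm]
    ring
  · rw [norm_neg]
    exact abs_thetaTerm_le le_rfl (le_of_lt hk) _ _
  all_goals exact half_lt_self hK

theorem thetaSeries_zero_of_even {j : ℕ} (hj : Even j) (K : ℝ) :
    thetaSeries j 0 K = 0 := by
  have h : thetaSeries j 0 K = -thetaSeries j 0 K := by
    unfold thetaSeries
    conv_lhs => rw [← (Equiv.subLeft (-1 : ℤ)).tsum_eq]
    rw [← tsum_neg]
    congr 1
    funext n
    simp only [thetaTerm, Equiv.subLeft_apply]
    rw [show ((-1 - n : ℤ) : ℝ) + 1 / 2 = -((n : ℝ) + 1 / 2) by push_cast; ring, hj.neg_pow,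
      neg_sq, zpow_sub₀ (by norm_num), zpow_neg_one]
    simp only [mul_zero]
    rcases Int.even_or_odd n with h | h
    · rw [h.neg_one_zpow]; norm_num
    · rw [h.neg_one_zpow]; norm_num
  linarith

/-- Quasi-periodicity of the theta series: `T (u + 2K) = - exp (u + K) T u`, differentiated. -/
theorem thetaSeries_add_two_mul (u : ℝ) {K : ℝ} (hK : 0 < K) (j : ℕ) :
    thetaSeries j (u + 2 * K) K = -Real.exp (u + K) *
      ∑ i ∈ Finset.range (j + 1), (j.choose i : ℝ) * thetaSeries i u K := by
  have h1 : thetaSeries j (u + 2 * K) K = ∑' n : ℤ, -Real.exp (u + K) *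
      ∑ i ∈ Finset.range (j + 1), (j.choose i : ℝ) * thetaTerm i u K n := by
    unfold thetaSeries
    rw [← (Equiv.addRight (1 : ℤ)).tsum_eq]
    congr 1
    funext n
    simp only [thetaTerm, Equiv.coe_addRight]
    rw [show ((n + 1 : ℤ) : ℝ) + 1 / 2 = ((n : ℝ) + 1 / 2) + 1 by push_cast; ring,
      zpow_add_one₀ (by norm_num), add_pow]
    rw [show -K * ((n : ℝ) + 1 / 2 + 1) ^ 2 + ((n : ℝ) + 1 / 2 + 1) * (u + 2 * K) =
      (u + K) + (-K * ((n : ℝ) + 1 / 2) ^ 2 + ((n : ℝ) + 1 / 2) * u) by ring, Real.exp_add]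
    rw [Finset.mul_sum, Finset.sum_mul, Finset.mul_sum]
    refine Finset.sum_congr rfl fun i _ => ?_
    rw [one_pow]
    ring
  rw [h1, tsum_mul_left, Summable.tsum_finsetSum
    (fun i _ => (summable_thetaTerm i u hK).mul_left _)]
  congr 1
  exact Finset.sum_congr rfl fun i _ => tsum_mul_left

/-- As `K → ∞` only the terms `n = 0` and `n = -1` of the theta series survive. -/
theorem tendsto_exp_mul_thetaSeries (j : ℕ) (u : ℝ) :
    Tendsto (fun K => Real.exp (K / 4) * thetaSeries j u K) atTop
      (𝓝 ((1 / 2) ^ j * Real.exp (u / 2) - (-1 / 2) ^ j * Real.exp (-u / 2))) := by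
  have hval : ∑' n : ℤ, (if n = 0 ∨ n = -1 then
      Real.exp (1 / 4) * thetaTerm j u 1 n else 0) =
      (1 / 2) ^ j * Real.exp (u / 2) - (-1 / 2) ^ j * Real.exp (-u / 2) := by
    rw [tsum_eq_sum (s := {0, -1})]
    · rw [Finset.sum_pair (by norm_num)]
      simp only [thetaTerm, true_or, or_true, if_true]
      rw [mul_left_comm, ← Real.exp_add, mul_left_comm (Real.exp (1 / 4)), ← Real.exp_add]
      rw [zpow_zero, zpow_neg_one]
      push_cast
      norm_num
      ring_nf
    · intro n hn
      rw [if_neg (by simpa using hn)]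
  rw [← hval]
  have hsum : ∀ K, Real.exp (K / 4) * thetaSeries j u K =
      ∑' n : ℤ, Real.exp (K / 4) * thetaTerm j u K n := fun K => tsum_mul_left.symm
  simp_rw [hsum]
  -- `n ² + n ≥ 0`, so the rescaled terms decrease in absolute value as `K` grows
  have hterm : ∀ (K : ℝ) (n : ℤ), Real.exp (K / 4) * thetaTerm j u K n =
      Real.exp (-(K - 1) * ((n : ℝ) ^ 2 + n)) * (Real.exp (1 / 4) * thetaTerm j u 1 n) := by
    intro K n
    unfold thetaTerm
    rw [show ∀ a b c d e f g : ℝ, a = c → b * d = e * (f * g) →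
      b * (a * d) = e * (f * (c * g)) by intro a b c d e f g h h'; rw [h]; linear_combination c * h']
    · rfl
    · rw [← Real.exp_add, ← Real.exp_add, ← Real.exp_add]
      congr 1
      ring
  have hnn : ∀ n : ℤ, 0 ≤ (n : ℝ) ^ 2 + n := by
    intro n
    have : 0 ≤ n ^ 2 + n := by
      rcases le_or_gt 0 n with h | h
      · positivity
      · nlinarith
    exact_mod_cast this
  refine tendsto_tsum_of_dominated_convergence
    (bound := fun n => Real.exp (1 / 4) * |thetaTerm j u 1 n|)
    ((summable_thetaTerm j u one_pos).abs.mul_left _) (fun n => ?_) ?_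
  · refine Tendsto.congr (fun K => (hterm K n).symm) ?_
    split_ifs with h
    · have h0 : (n : ℝ) ^ 2 + n = 0 := by rcases h with rfl | rfl <;> norm_num
      refine tendsto_const_nhds.congr fun K => ?_
      rw [h0, mul_zero, Real.exp_zero, one_mul]
    · have h0 : 0 < (n : ℝ) ^ 2 + n := by
        refine lt_of_le_of_ne (hnn n) (fun h' => h ?_)
        have : n * (n + 1) = 0 := by
          have h'' : (n : ℝ) * (n + 1) = 0 := by linarith
          exact_mod_cast h''
        rcases mul_eq_zero.mp this with h | h <;> omega
      rw [← zero_mul (Real.exp (1 / 4) * thetaTerm j u 1 n)]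
      refine Tendsto.mul_const _ ?_
      refine Real.tendsto_exp_atBot.comp ?_
      refine Tendsto.atBot_mul_const h0 ?_
      exact tendsto_neg_atTop_atBot.comp (tendsto_atTop_add_const_right _ _ tendsto_id)
  · filter_upwards [eventually_ge_atTop 1] with K hK n
    rw [hterm, norm_mul, norm_mul, Real.norm_eq_abs, Real.norm_eq_abs, Real.abs_exp, Real.abs_exp,
      Real.norm_eq_abs]
    have : Real.exp (-(K - 1) * ((n : ℝ) ^ 2 + n)) ≤ 1 := by
      rw [Real.exp_le_one_iff]
      nlinarith [hnn n]
    have h2 : 0 ≤ Real.exp (1 / 4) * |thetaTerm j u 1 n| := by positivity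
    nlinarith

/-! ### The bilinear identity of the theta series -/

/-- Sum and half-difference coordinates on pairs of half-integers, split by the parity of the
difference. -/
def pairParityEquiv : (ℤ × ℤ) ⊕ (ℤ × ℤ) ≃ ℤ × ℤ where
  toFun := Sum.elim (fun p => (p.1 + p.2, p.1 - p.2)) (fun p => (p.1 + p.2, p.1 - p.2 - 1))
  invFun p := if Even (p.1 - p.2) then Sum.inl ((p.1 + p.2) / 2, (p.1 - p.2) / 2)
    else Sum.inr ((p.1 + p.2 + 1) / 2, (p.1 - p.2 - 1) / 2)
  left_inv := by
    rintro (⟨a, b⟩ | ⟨a, b⟩)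
    · have h : Even (a + b - (a - b)) := ⟨b, by ring⟩
      simp only [Sum.elim_inl, h, if_true, Sum.inl.injEq, Prod.mk.injEq]
      omega
    · have h : ¬ Even (a + b - (a - b - 1)) := by
        rw [Int.not_even_iff_odd]
        exact ⟨b, by ring⟩
      simp only [Sum.elim_inr, h, if_false, Sum.inr.injEq, Prod.mk.injEq]
      omega
  right_inv := by
    rintro ⟨m, n⟩
    by_cases h : Even (m - n)
    · obtain ⟨r, hr⟩ := h
      simp only [show Even (m - n) from ⟨r, hr⟩, if_true, Sum.elim_inl, Prod.mk.injEq]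
      omega
    · have h' := h
      rw [Int.not_even_iff_odd] at h'
      obtain ⟨r, hr⟩ := h'
      simp only [h, if_false, Sum.elim_inr, Prod.mk.injEq]
      omega

/-- The Gaussian moments `∑ d^j exp (-K d² / 2)` over `d ∈ 2 ℤ + s`. -/
noncomputable def latticeMoment (s : ℝ) (j : ℕ) (K : ℝ) : ℝ :=
  ∑' b : ℤ, (2 * (b : ℝ) + s) ^ j * Real.exp (-K * (2 * (b : ℝ) + s) ^ 2 / 2)

/-- The second order theta functions `∑ exp (-K t² / 2 + t u)` over `t ∈ 2 ℤ + s`. -/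
noncomputable def latticeTheta (s u K : ℝ) : ℝ :=
  ∑' a : ℤ, Real.exp (-K * (2 * (a : ℝ) + s) ^ 2 / 2 + (2 * (a : ℝ) + s) * u)

theorem summable_pow_mul_exp_quadratic (j : ℕ) (s u : ℝ) {K : ℝ} (hK : 0 < K) :
    Summable fun b : ℤ =>
      (2 * (b : ℝ) + s) ^ j * Real.exp (-K * (2 * (b : ℝ) + s) ^ 2 / 2 + (2 * (b : ℝ) + s) * u) := by
  have h (i : ℕ) := summable_pow_mul_jacobiTheta₂_term_bound ((|K * s| + |u|) / π)
    (div_pos (mul_pos two_pos hK) Real.pi_pos) i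
  have h2 := ((h j).add (h 0)).mul_left ((2 + |s|) ^ j * 2 ^ j * Real.exp (|s| * |u|))
  refine Summable.of_norm_bounded h2 (fun n => ?_)
  have hπ := Real.pi_pos
  have e : -π * (2 * K / π * (n : ℝ) ^ 2 - 2 * ((|K * s| + |u|) / π) * ((|n| : ℤ) : ℝ)) =
      -(2 * K) * (n : ℝ) ^ 2 + 2 * (|K * s| + |u|) * |(n : ℝ)| := by
    push_cast
    field_simp
    ring
  simp only [e]
  rw [show ∀ a b c d : ℝ, a * b * (c * d + ((|n| : ℤ) : ℝ) ^ 0 * d) = (a * (c + 1)) * (b * d) by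
    intros; rw [pow_zero]; ring, ← Real.exp_add, Real.norm_eq_abs, abs_mul, Real.abs_exp, abs_pow]
  push_cast
  apply mul_le_mul _ _ (Real.exp_pos _).le (by positivity)
  · have h1 : |2 * (n : ℝ) + s| ≤ (2 + |s|) * (|(n : ℝ)| + 1) := by
      have := abs_add_le (2 * (n : ℝ)) s
      rw [abs_mul, abs_two] at this
      nlinarith [mul_nonneg (abs_nonneg s) (abs_nonneg (n : ℝ))]
    calc |2 * (n : ℝ) + s| ^ j ≤ ((2 + |s|) * (|(n : ℝ)| + 1)) ^ j := by gcongr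
      _ = (2 + |s|) ^ j * (|(n : ℝ)| + 1) ^ j := mul_pow _ _ _
      _ ≤ (2 + |s|) ^ j * (2 ^ (j - 1) * (|(n : ℝ)| ^ j + 1 ^ j)) := by
        gcongr
        exact add_pow_le (abs_nonneg _) zero_le_one j
      _ ≤ (2 + |s|) ^ j * (2 ^ j * (|(n : ℝ)| ^ j + 1)) := by
        rw [one_pow]
        gcongr
        · norm_num
        · omega
      _ = _ := by ring
  · apply Real.exp_le_exp.mpr
    have h3 : -(K * s * n) ≤ |K * s| * |(n : ℝ)| := by
      rw [← abs_mul]; exact neg_le_abs _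
    have h4 : (n : ℝ) * u ≤ |(n : ℝ)| * |u| := by
      rw [← abs_mul]; exact le_abs_self _
    have h5 : s * u ≤ |s| * |u| := by
      rw [← abs_mul]; exact le_abs_self _
    nlinarith [mul_nonneg hK.le (sq_nonneg s)]

/-- A bilinear sum weighted by a power of the difference of the two half-integers separates in the
sum and difference coordinates. -/
theorem hasSum_sub_pow_mul_thetaTerm (j : ℕ) (u : ℝ) {K : ℝ} (hK : 0 < K) :
    HasSum (fun p : ℤ × ℤ => ((p.1 : ℝ) - p.2) ^ j * (thetaTerm 0 u K p.1 * thetaTerm 0 u K p.2))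
      (latticeTheta 1 u K * latticeMoment 0 j K - latticeTheta 0 u K * latticeMoment 1 j K) := by
  have hA (s : ℝ) : HasSum (fun a : ℤ => Real.exp (-K * (2 * (a : ℝ) + s) ^ 2 / 2 +
      (2 * (a : ℝ) + s) * u)) (latticeTheta s u K) := by
    have := summable_pow_mul_exp_quadratic 0 s u hK
    simp only [pow_zero, one_mul] at this
    exact this.hasSum
  have hM (s : ℝ) : HasSum (fun b : ℤ => (2 * (b : ℝ) + s) ^ j *
      Real.exp (-K * (2 * (b : ℝ) + s) ^ 2 / 2)) (latticeMoment s j K) := by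
    have := summable_pow_mul_exp_quadratic j s 0 hK
    simp only [mul_zero, add_zero] at this
    exact this.hasSum
  have hp (s t : ℝ) := (hA s).mul (hM t)
    (summable_mul_of_summable_norm (hA s).summable.norm (hM t).summable.norm)
  rw [← pairParityEquiv.hasSum_iff, sub_eq_add_neg]
  refine HasSum.sum ?_ ?_
  · refine (congrArg (HasSum · _) (funext fun p => ?_)).mpr (hp 1 0)
    obtain ⟨a, b⟩ := p
    simp only [pairParityEquiv, Function.comp, Equiv.coe_fn_mk, Sum.elim_inl, thetaTerm, pow_zero]
    have hs : (-1 : ℝ) ^ (a + b) * (-1) ^ (a - b) = 1 := by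
      rw [← zpow_add₀ (by norm_num)]
      exact Even.neg_one_zpow ⟨a, by ring⟩
    push_cast
    rw [show ∀ x p q E F : ℝ, x * (p * 1 * E * (q * 1 * F)) = x * (p * q) * (E * F) by
      intros; ring, hs, ← Real.exp_add, mul_left_comm, ← Real.exp_add, mul_one]
    congr 1 <;> ring_nf
  · refine (congrArg (HasSum · _) (funext fun p => ?_)).mpr (hp 0 1).neg
    obtain ⟨a, b⟩ := p
    simp only [pairParityEquiv, Function.comp, Equiv.coe_fn_mk, Sum.elim_inr, thetaTerm, pow_zero]
    have hs : (-1 : ℝ) ^ (a + b) * (-1) ^ (a - b - 1) = -1 := by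
      rw [← zpow_add₀ (by norm_num)]
      exact Odd.neg_one_zpow ⟨a - 1, by ring⟩
    push_cast
    rw [show ∀ x p q E F : ℝ, x * (p * 1 * E * (q * 1 * F)) = x * (p * q) * (E * F) by
      intros; ring, hs, ← Real.exp_add, mul_left_comm, ← Real.exp_add, mul_neg_one, neg_mul]
    congr 2 <;> ring_nf

theorem thetaTerm_eq_pow_mul (j : ℕ) (u K : ℝ) (n : ℤ) :
    thetaTerm j u K n = ((n : ℝ) + 1 / 2) ^ j * thetaTerm 0 u K n := by
  unfold thetaTerm
  ring

theorem hasSum_thetaTerm_mul (i j : ℕ) (u : ℝ) {K : ℝ} (hK : 0 < K) :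
    HasSum (fun p : ℤ × ℤ => thetaTerm i u K p.1 * thetaTerm j u K p.2)
      (thetaSeries i u K * thetaSeries j u K) :=
  (hasSum_thetaTerm i u hK).mul (hasSum_thetaTerm j u hK)
    (summable_mul_of_summable_norm (summable_thetaTerm i u hK).norm
      (summable_thetaTerm j u hK).norm)

theorem thetaSeries_sq_eq (u : ℝ) {K : ℝ} (hK : 0 < K) :
    thetaSeries 0 u K ^ 2 =
      latticeTheta 1 u K * latticeMoment 0 0 K - latticeTheta 0 u K * latticeMoment 1 0 K := by
  refine HasSum.unique ?_ (hasSum_sub_pow_mul_thetaTerm 0 u hK)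
  rw [sq]
  exact (congrArg (HasSum · _) (funext fun p => by rw [pow_zero, one_mul])).mpr (hasSum_thetaTerm_mul 0 0 u hK)

theorem thetaSeries_wronskian_eq (u : ℝ) {K : ℝ} (hK : 0 < K) :
    2 * (thetaSeries 0 u K * thetaSeries 2 u K) - 2 * (thetaSeries 1 u K * thetaSeries 1 u K) =
      latticeTheta 1 u K * latticeMoment 0 2 K - latticeTheta 0 u K * latticeMoment 1 2 K := by
  refine HasSum.unique ?_ (hasSum_sub_pow_mul_thetaTerm 2 u hK)
  have h := (((hasSum_thetaTerm_mul 0 2 u hK).add (hasSum_thetaTerm_mul 2 0 u hK))).sub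
    ((hasSum_thetaTerm_mul 1 1 u hK).mul_left 2)
  rw [show 2 * (thetaSeries 0 u K * thetaSeries 2 u K) = thetaSeries 0 u K * thetaSeries 2 u K +
    thetaSeries 2 u K * thetaSeries 0 u K by ring]
  refine (congrArg (HasSum · _) (funext fun p => ?_)).mpr h
  simp only [thetaTerm_eq_pow_mul 1, thetaTerm_eq_pow_mul 2]
  ring

theorem thetaSeries_quartic_eq (u : ℝ) {K : ℝ} (hK : 0 < K) :
    2 * (thetaSeries 0 u K * thetaSeries 4 u K) - 8 * (thetaSeries 1 u K * thetaSeries 3 u K) +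
        6 * (thetaSeries 2 u K * thetaSeries 2 u K) =
      latticeTheta 1 u K * latticeMoment 0 4 K - latticeTheta 0 u K * latticeMoment 1 4 K := by
  refine HasSum.unique ?_ (hasSum_sub_pow_mul_thetaTerm 4 u hK)
  have h := (((hasSum_thetaTerm_mul 0 4 u hK).add (hasSum_thetaTerm_mul 4 0 u hK)).sub
    (((hasSum_thetaTerm_mul 1 3 u hK).add (hasSum_thetaTerm_mul 3 1 u hK)).mul_left 4)).add
    ((hasSum_thetaTerm_mul 2 2 u hK).mul_left 6)
  rw [show 2 * (thetaSeries 0 u K * thetaSeries 4 u K) -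
      8 * (thetaSeries 1 u K * thetaSeries 3 u K) = thetaSeries 0 u K * thetaSeries 4 u K +
    thetaSeries 4 u K * thetaSeries 0 u K - 4 * (thetaSeries 1 u K * thetaSeries 3 u K +
    thetaSeries 3 u K * thetaSeries 1 u K) by ring]
  refine (congrArg (HasSum · _) (funext fun p => ?_)).mpr h
  simp only [thetaTerm_eq_pow_mul 1, thetaTerm_eq_pow_mul 2, thetaTerm_eq_pow_mul 3,
    thetaTerm_eq_pow_mul 4]
  ring

theorem latticeMoment_zero_zero_pos {K : ℝ} (hK : 0 < K) : 0 < latticeMoment 0 0 K := by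
  have h := summable_pow_mul_exp_quadratic 0 0 0 hK
  simp only [mul_zero, add_zero] at h
  unfold latticeMoment
  simp only [add_zero]
  exact h.tsum_pos (fun b => by positivity) 0 (by positivity)

/-- Hirota's bilinear form of the differential equation of the Weierstrass function. The three
bilinear expressions lie in a space of second order theta functions spanned by two elements, so
they are linearly dependent; the coefficients are read off from the Taylor expansion at `0`. -/
theorem thetaSeries_hirota (u : ℝ) {K : ℝ} (hK : 0 < K) (hd : thetaSeries 1 0 K ≠ 0) :
    thetaSeries 1 0 K ^ 2 * (thetaSeries 0 u K * thetaSeries 4 u K -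
        4 * (thetaSeries 1 u K * thetaSeries 3 u K) + 3 * thetaSeries 2 u K ^ 2) +
      4 * (thetaSeries 1 0 K * thetaSeries 3 0 K) *
        (thetaSeries 1 u K ^ 2 - thetaSeries 0 u K * thetaSeries 2 u K) =
      (thetaSeries 3 0 K ^ 2 - thetaSeries 1 0 K * thetaSeries 5 0 K) * thetaSeries 0 u K ^ 2 := by
  obtain ⟨α, hα⟩ : ∃ α, α = latticeMoment 0 2 K * latticeMoment 1 0 K -
    latticeMoment 1 2 K * latticeMoment 0 0 K := ⟨_, rfl⟩
  obtain ⟨β, hβ⟩ : ∃ β, β = latticeMoment 0 0 K * latticeMoment 1 4 K -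
    latticeMoment 1 0 K * latticeMoment 0 4 K := ⟨_, rfl⟩
  obtain ⟨γ, hγ⟩ : ∃ γ, γ = latticeMoment 0 4 K * latticeMoment 1 2 K -
    latticeMoment 1 4 K * latticeMoment 0 2 K := ⟨_, rfl⟩
  have e0 (j) (hj : Even j) := thetaSeries_zero_of_even hj K
  have z0 := e0 0 (by decide)
  have z2 := e0 2 (by decide)
  have z4 := e0 4 (by decide)
  have z6 := e0 6 (by decide)
  -- the linear dependence
  have hdep : ∀ v, α * (2 * (thetaSeries 0 v K * thetaSeries 4 v K) -
      8 * (thetaSeries 1 v K * thetaSeries 3 v K) + 6 * (thetaSeries 2 v K * thetaSeries 2 v K)) +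
      β * (2 * (thetaSeries 0 v K * thetaSeries 2 v K) -
        2 * (thetaSeries 1 v K * thetaSeries 1 v K)) +
      γ * thetaSeries 0 v K ^ 2 = 0 := by
    intro v
    rw [thetaSeries_sq_eq v hK, thetaSeries_wronskian_eq v hK, thetaSeries_quartic_eq v hK,
      hα, hβ, hγ]
    ring
  have hαne : α ≠ 0 := by
    intro h
    have h1 := thetaSeries_sq_eq 0 hK
    have h2 := thetaSeries_wronskian_eq 0 hK
    rw [z0] at h1 h2
    have h3 : latticeMoment 0 0 K * thetaSeries 1 0 K ^ 2 = 0 := by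
      linear_combination (-1 / 2) * latticeMoment 0 0 K * h2 +
        (1 / 2) * latticeMoment 0 2 K * h1 - (1 / 2) * latticeTheta 0 0 K * (hα.symm.trans h)
    rcases mul_eq_zero.mp h3 with h4 | h4
    · exact (latticeMoment_zero_zero_pos hK).ne' h4
    · exact hd (pow_eq_zero_iff two_ne_zero |>.mp h4)
  -- the first two derivatives of the dependence
  have D (j : ℕ) (v : ℝ) := hasDerivAt_thetaSeries_left j v hK
  have hdep1 : ∀ v, α * (2 * (thetaSeries 0 v K * thetaSeries 5 v K) -
      6 * (thetaSeries 1 v K * thetaSeries 4 v K) + 4 * (thetaSeries 2 v K * thetaSeries 3 v K)) +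
      β * (2 * (thetaSeries 0 v K * thetaSeries 3 v K) -
        2 * (thetaSeries 1 v K * thetaSeries 2 v K)) +
      γ * (2 * (thetaSeries 0 v K * thetaSeries 1 v K)) = 0 := by
    intro v
    have h := ((((((D 0 v).mul (D 4 v)).const_mul 2).sub
      (((D 1 v).mul (D 3 v)).const_mul 8)).add
      (((D 2 v).mul (D 2 v)).const_mul 6)).const_mul α).add
      (((((D 0 v).mul (D 2 v)).const_mul 2).sub
      (((D 1 v).mul (D 1 v)).const_mul 2)).const_mul β) |>.add
      (((D 0 v).pow 2).const_mul γ)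
    have h0 := h.unique ((hasDerivAt_const v (0 : ℝ)).congr_of_eventuallyEq
      (Eventually.of_forall fun w => hdep w))
    norm_num at h0
    linear_combination h0
  have hdep2 : α * (4 * (thetaSeries 3 0 K ^ 2 - thetaSeries 1 0 K * thetaSeries 5 0 K)) +
      γ * (2 * thetaSeries 1 0 K ^ 2) = 0 := by
    have h := ((((((D 0 0).mul (D 5 0)).const_mul 2).sub
      (((D 1 0).mul (D 4 0)).const_mul 6)).add
      (((D 2 0).mul (D 3 0)).const_mul 4)).const_mul α).add
      (((((D 0 0).mul (D 3 0)).const_mul 2).sub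
      (((D 1 0).mul (D 2 0)).const_mul 2)).const_mul β) |>.add
      ((((D 0 0).mul (D 1 0)).const_mul 2).const_mul γ)
    have h0 := h.unique ((hasDerivAt_const (0 : ℝ) (0 : ℝ)).congr_of_eventuallyEq
      (Eventually.of_forall fun w => hdep1 w))
    norm_num [z0, z2, z4, z6] at h0
    linear_combination h0
  have hdep0 : 4 * α * thetaSeries 3 0 K + β * thetaSeries 1 0 K = 0 := by
    have h0 := hdep 0
    rw [z0, z2] at h0
    refine mul_left_cancel₀ hd ?_
    linear_combination (-1 / 2) * h0
  have hfin := hdep u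
  refine mul_left_cancel₀ hαne ?_
  linear_combination (thetaSeries 1 0 K ^ 2 / 2) * hfin + (thetaSeries 1 0 K) *
    (thetaSeries 1 u K ^ 2 - thetaSeries 0 u K * thetaSeries 2 u K) * hdep0 -
    thetaSeries 0 u K ^ 2 / 4 * hdep2

/-! ### The product formula -/

/-- The coefficients of the finite triple product: for `Q = q ^ (N + 1)` this is, up to sign, the
Gaussian binomial coefficient `[2N + 1, N - n]` divided by `[2N + 1, N]`, times `q ^ (n (n + 1) / 2)`. -/
noncomputable def tripleCoeff (q Q : ℝ) (n : ℕ) : ℝ :=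
  ∏ i ∈ Finset.range n, (Q - q ^ (i + 1)) / (1 - Q * q ^ (i + 1))

/-- The ratio of two consecutive normalising constants of the finite triple product, for
`Q = q ^ (N + 1)`. -/
noncomputable def tripleFactor (q Q : ℝ) : ℝ := (1 + Q) * (1 - q * Q ^ 2) / (1 - q * Q)

theorem one_sub_mul_pow_pos {q Q : ℝ} (hq0 : 0 ≤ q) (hq1 : q < 1) (hQ0 : 0 ≤ Q) (hQ1 : Q < 1)
    (n : ℕ) : 0 < 1 - Q * q ^ n := by
  have := pow_le_one₀ (n := n) hq0 hq1.le
  have := pow_nonneg hq0 n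
  nlinarith

theorem tripleCoeff_succ (q Q : ℝ) (n : ℕ) :
    tripleCoeff q Q (n + 1) =
      tripleCoeff q Q n * ((Q - q ^ (n + 1)) / (1 - Q * q ^ (n + 1))) := by
  unfold tripleCoeff
  rw [Finset.prod_range_succ]

theorem tripleCoeff_shift {q Q : ℝ} (hq0 : 0 ≤ q) (hq1 : q < 1) (hQ0 : 0 ≤ Q) (hQ1 : Q < 1)
    (m : ℕ) : tripleCoeff q (q * Q) (m + 1) =
      tripleCoeff q Q m * (q ^ (m + 1) * (Q - 1) * (1 - Q * q) /
        ((1 - Q * q ^ (m + 2)) * (1 - Q * q ^ (m + 1)))) := by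
  have hne (n : ℕ) : 1 - Q * q ^ n ≠ 0 := (one_sub_mul_pow_pos hq0 hq1 hQ0 hQ1 n).ne'
  induction m with
  | zero =>
    have h1 := hne 1
    have h2 := hne 2
    rw [pow_one] at h1
    simp only [tripleCoeff, zero_add, Finset.prod_range_one, Finset.prod_range_zero, pow_one]
    rw [show q * Q * q = Q * q ^ 2 by ring]
    generalize 1 - Q * q ^ 2 = D₂ at *
    generalize 1 - Q * q = D₁ at *
    field_simp
  | succ m ih =>
    rw [tripleCoeff_succ q (q * Q) (m + 1), ih, tripleCoeff_succ q Q m]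
    have h1 := hne (m + 1)
    have h2 := hne (m + 2)
    have h3 := hne (m + 3)
    have h4 : 1 - q * Q * q ^ (m + 1 + 1) ≠ 0 := by
      rwa [show q * Q * q ^ (m + 1 + 1) = Q * q ^ (m + 3) by ring]
    simp only [show m + 1 + 1 = m + 2 from rfl, show m + 1 + 2 = m + 3 from rfl] at *
    rw [show q * Q * q ^ (m + 2) = Q * q ^ (m + 3) by ring]
    field_simp
    ring

theorem tripleCoeff_recurrence {q Q : ℝ} (hq0 : 0 ≤ q) (hq1 : q < 1) (hQ0 : 0 ≤ Q) (hQ1 : Q < 1)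
    (m : ℕ) : (1 + Q ^ 2) * tripleCoeff q Q (m + 1) -
      tripleFactor q Q * tripleCoeff q (q * Q) (m + 1) =
      Q * (tripleCoeff q Q m + tripleCoeff q Q (m + 2)) := by
  have hne (n : ℕ) : 1 - Q * q ^ n ≠ 0 := (one_sub_mul_pow_pos hq0 hq1 hQ0 hQ1 n).ne'
  rw [tripleCoeff_shift hq0 hq1 hQ0 hQ1, tripleCoeff_succ q Q (m + 1), tripleCoeff_succ q Q m,
    tripleFactor]
  have h0 := hne 1
  have h1 := hne (m + 1)
  have h2 := hne (m + 2)
  rw [pow_one, mul_comm] at h0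
  rw [mul_comm Q q, show m + 1 + 1 = m + 2 from rfl]
  rw [pow_succ q (m + 1)] at *
  generalize q ^ (m + 1) = y at *
  generalize hD₀ : 1 - q * Q = D₀ at *
  generalize hD₁ : 1 - Q * y = D₁ at *
  generalize hD₂ : 1 - Q * (y * q) = D₂ at *
  field_simp
  rw [← hD₁, ← hD₂]
  ring

theorem tripleCoeff_recurrence_zero {q Q : ℝ} (hq0 : 0 ≤ q) (hq1 : q < 1) (hQ0 : 0 ≤ Q)
    (hQ1 : Q < 1) : 1 + Q ^ 2 - tripleFactor q Q = Q * (-1 + tripleCoeff q Q 1) := by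
  have h0 := (one_sub_mul_pow_pos hq0 hq1 hQ0 hQ1 1).ne'
  rw [pow_one, mul_comm] at h0
  simp only [tripleFactor, tripleCoeff, Finset.prod_range_one, zero_add, pow_one, mul_comm Q q]
  generalize hD₀ : 1 - q * Q = D₀ at *
  field_simp
  rw [← hD₀]
  ring

theorem sinh_half_recurrence (u : ℝ) (x : ℝ) :
    2 * Real.cosh u * Real.sinh (x * u) = Real.sinh ((x + 1) * u) + Real.sinh ((x - 1) * u) := by
  rw [add_mul, sub_mul, one_mul, Real.sinh_add, Real.sinh_sub]
  ring

theorem sum_tripleCoeff_telescope {q Q : ℝ} (hq0 : 0 ≤ q) (hq1 : q < 1) (hQ0 : 0 ≤ Q)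
    (hQ1 : Q < 1) (u : ℝ) (M : ℕ) :
    (1 - 2 * Q * Real.cosh u + Q ^ 2) *
        ∑ n ∈ Finset.range (M + 1), tripleCoeff q Q n * Real.sinh (((n : ℝ) + 1 / 2) * u) =
      tripleFactor q Q *
        ∑ n ∈ Finset.range (M + 1), tripleCoeff q (q * Q) n * Real.sinh (((n : ℝ) + 1 / 2) * u) +
      Q * (tripleCoeff q Q (M + 1) * Real.sinh (((M : ℝ) + 1 / 2) * u) -
        tripleCoeff q Q M * Real.sinh (((M : ℝ) + 3 / 2) * u)) := by
  induction M with
  | zero =>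
    have h := tripleCoeff_recurrence_zero hq0 hq1 hQ0 hQ1
    have h2 := sinh_half_recurrence u (1 / 2)
    rw [show ((1 : ℝ) / 2 - 1) * u = -(1 / 2 * u) by ring, Real.sinh_neg] at h2
    have c0 : ∀ Q', tripleCoeff q Q' 0 = 1 := fun Q' => by simp [tripleCoeff]
    simp only [zero_add, Finset.sum_range_one, c0, Nat.cast_zero]
    rw [show (3 : ℝ) / 2 = 1 / 2 + 1 by norm_num]
    linear_combination Real.sinh (1 / 2 * u) * h - Q * h2
  | succ M ih =>
    rw [Finset.sum_range_succ, mul_add, ih, Finset.sum_range_succ _ (M + 1)]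
    have h := tripleCoeff_recurrence hq0 hq1 hQ0 hQ1 M
    have h2 := sinh_half_recurrence u ((M : ℝ) + 1 + 1 / 2)
    rw [show (M : ℝ) + 1 + 1 / 2 - 1 = M + 1 / 2 by ring,
      show (M : ℝ) + 1 + 1 / 2 + 1 = M + 1 + 3 / 2 by ring] at h2
    rw [show (M : ℝ) + 3 / 2 = M + 1 + 1 / 2 by ring]
    push_cast
    linear_combination Real.sinh (((M : ℝ) + 1 + 1 / 2) * u) * h -
      Q * tripleCoeff q Q (M + 1) * h2

theorem tripleCoeff_eq_zero (q : ℝ) {N n : ℕ} (h : N < n) : tripleCoeff q (q ^ (N + 1)) n = 0 :=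
  Finset.prod_eq_zero (Finset.mem_range.mpr h) (by simp)

/-- The finite form of the Jacobi triple product, in its odd symmetric version. -/
theorem finite_triple_product {q : ℝ} (hq0 : 0 < q) (hq1 : q < 1) (u : ℝ) (N : ℕ) :
    Real.sinh (u / 2) *
        ∏ k ∈ Finset.range N, (1 - 2 * q ^ (k + 1) * Real.cosh u + (q ^ (k + 1)) ^ 2) =
      (∏ k ∈ Finset.range N, tripleFactor q (q ^ (k + 1))) *
        ∑ n ∈ Finset.range (N + 1),
          tripleCoeff q (q ^ (N + 1)) n * Real.sinh (((n : ℝ) + 1 / 2) * u) := by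
  induction N with
  | zero =>
    simp [tripleCoeff]
    ring_nf
  | succ N ih =>
    rw [Finset.prod_range_succ, ← mul_assoc, ih,
      Finset.prod_range_succ (fun k => tripleFactor q (q ^ (k + 1)))]
    have h := sum_tripleCoeff_telescope hq0.le hq1 (pow_nonneg hq0.le (N + 1))
      (pow_lt_one₀ hq0.le hq1 (Nat.succ_ne_zero N)) u (N + 1)
    rw [Finset.sum_range_succ, tripleCoeff_eq_zero q (Nat.lt_succ_self N),
      tripleCoeff_eq_zero q (show N < N + 1 + 1 by omega), ← pow_succ'] at h
    linear_combination (∏ k ∈ Finset.range N, tripleFactor q (q ^ (k + 1))) * h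

theorem tripleFactor_pos {q Q : ℝ} (hq0 : 0 < q) (hq1 : q < 1) (hQ0 : 0 < Q) (hQ1 : Q < 1) :
    0 < tripleFactor q Q := by
  have h1 : 0 < 1 - q * Q := by nlinarith
  have h2 : 0 < 1 - q * Q ^ 2 := by nlinarith [mul_pos hq0 hQ0]
  unfold tripleFactor
  positivity

theorem tripleFactor_mul_le {q Q : ℝ} (hq0 : 0 < q) (hq1 : q < 1) (hQ0 : 0 < Q) (hQ1 : Q < 1) :
    tripleFactor q Q * ((1 - Q) * (1 - q * Q)) ≤ 1 := by
  have h1 : 0 < 1 - q * Q := by nlinarith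
  unfold tripleFactor
  rw [div_mul_eq_mul_div, div_le_one h1]
  have h2 : (1 - Q ^ 2) * (1 - q * Q ^ 2) ≤ 1 := by
    have : 0 ≤ q * Q ^ 2 := by positivity
    have : q * Q ^ 2 ≤ 1 := by nlinarith
    nlinarith [sq_nonneg Q]
  nlinarith

theorem exists_pos_le_prod_one_sub {x : ℕ → ℝ} (h0 : ∀ n, 0 ≤ x n) (h1 : ∀ n, x n < 1)
    (hs : Summable x) : ∃ δ > 0, ∀ N, δ ≤ ∏ n ∈ Finset.range N, (1 - x n) := by
  have hl : Summable fun n => Real.log (1 - x n) := by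
    have := Real.summable_log_one_add_of_summable hs.neg
    simpa [sub_eq_add_neg] using this
  refine ⟨Real.exp (∑' n, Real.log (1 - x n)), Real.exp_pos _, fun N => ?_⟩
  have h2 : ∏ n ∈ Finset.range N, (1 - x n) =
      Real.exp (∑ n ∈ Finset.range N, Real.log (1 - x n)) := by
    rw [Real.exp_sum]
    exact Finset.prod_congr rfl fun n _ => (Real.exp_log (sub_pos.mpr (h1 n))).symm
  rw [h2, Real.exp_le_exp]
  have h3 := hl.neg.sum_le_tsum (Finset.range N) fun n _ =>
    neg_nonneg.mpr (Real.log_nonpos (sub_pos.mpr (h1 n)).le (by linarith [h0 n]))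
  rw [tsum_neg, Finset.sum_neg_distrib] at h3
  linarith

theorem one_sub_le_prod_one_sub {x : ℕ → ℝ} (h0 : ∀ n, 0 ≤ x n) (h1 : ∀ n, x n ≤ 1) (N : ℕ) :
    1 - ∑ n ∈ Finset.range N, x n ≤ ∏ n ∈ Finset.range N, (1 - x n) := by
  induction N with
  | zero => simp
  | succ N ih =>
    rw [Finset.sum_range_succ, Finset.prod_range_succ]
    have h2 : ∏ n ∈ Finset.range N, (1 - x n) ≤ 1 :=
      Finset.prod_le_one (fun n _ => sub_nonneg.mpr (h1 n)) fun n _ => by linarith [h0 n]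
    nlinarith [h0 N]

/-- The limits of the coefficients `tripleCoeff q (q ^ (N + 1)) n`. -/
theorem tendsto_tripleCoeff {q : ℝ} (hq0 : 0 < q) (hq1 : q < 1) (n : ℕ) :
    Tendsto (fun N : ℕ => tripleCoeff q (q ^ (N + 1)) n) atTop
      (𝓝 (∏ i ∈ Finset.range n, -q ^ (i + 1))) := by
  refine tendsto_finsetProd _ fun i _ => ?_
  have h : Tendsto (fun N : ℕ => q ^ (N + 1)) atTop (𝓝 0) :=
    (tendsto_pow_atTop_nhds_zero_of_lt_one hq0.le hq1).comp (tendsto_add_atTop_nat 1)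
  have := (h.sub_const (q ^ (i + 1))).div ((h.mul_const (q ^ (i + 1))).const_sub 1) (by norm_num)
  rwa [zero_mul, zero_sub, sub_zero, div_one] at this

theorem abs_tripleCoeff_le {q : ℝ} (hq0 : 0 < q) (hq1 : q < 1) (N n : ℕ) :
    |tripleCoeff q (q ^ (N + 1)) n| ≤ |∏ i ∈ Finset.range n, -q ^ (i + 1)| := by
  rcases lt_or_ge N n with h | h
  · rw [tripleCoeff_eq_zero q h, abs_zero]
    exact abs_nonneg _
  · unfold tripleCoeff
    rw [Finset.abs_prod, Finset.abs_prod]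
    refine Finset.prod_le_prod (fun i _ => abs_nonneg _) fun i hi => ?_
    have hi' : i + 1 ≤ N + 1 := by
      have := Finset.mem_range.mp hi
      omega
    have hQ : q ^ (N + 1) ≤ q ^ (i + 1) := pow_le_pow_of_le_one hq0.le hq1.le hi'
    have hQ0 : 0 < q ^ (N + 1) := pow_pos hq0 _
    have hQ1 : q ^ (N + 1) < 1 := pow_lt_one₀ hq0.le hq1 (Nat.succ_ne_zero N)
    have hd := one_sub_mul_pow_pos hq0.le hq1 hQ0.le hQ1 (i + 1)
    have hi0 : 0 < q ^ (i + 1) := pow_pos hq0 _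
    have hi1 : q ^ (i + 1) ≤ 1 := pow_le_one₀ hq0.le hq1.le
    rw [abs_neg, abs_of_pos hi0, abs_div, abs_of_pos hd, div_le_iff₀ hd,
      abs_of_nonpos (by linarith)]
    have : q ^ (i + 1) * q ^ (i + 1) ≤ 1 := by nlinarith
    nlinarith

theorem prod_neg_exp_pow (K : ℝ) (n : ℕ) :
    ∏ i ∈ Finset.range n, -Real.exp (-(2 * K)) ^ (i + 1) =
      (-1) ^ n * Real.exp (-K * ((n : ℝ) ^ 2 + n)) := by
  induction n with
  | zero => simp
  | succ n ih =>
    rw [Finset.prod_range_succ, ih, ← Real.exp_nat_mul, pow_succ]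
    rw [show -K * (((n + 1 : ℕ) : ℝ) ^ 2 + ((n + 1 : ℕ) : ℝ)) =
      -K * ((n : ℝ) ^ 2 + n) + ((n + 1 : ℕ) : ℝ) * -(2 * K) by push_cast; ring, Real.exp_add]
    ring_nf

theorem hasSum_sinh_thetaSeries (u : ℝ) {K : ℝ} (hK : 0 < K) :
    HasSum (fun n : ℕ => (∏ i ∈ Finset.range n, -Real.exp (-(2 * K)) ^ (i + 1)) *
      Real.sinh (((n : ℝ) + 1 / 2) * u)) (Real.exp (K / 4) * thetaSeries 0 u K / 2) := by
  have h := ((hasSum_thetaTerm 0 u hK).nat_add_neg_add_one.mul_left (Real.exp (K / 4))).div_const 2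
  refine (congrArg (HasSum · _) (funext fun n => ?_)).mpr h
  rw [prod_neg_exp_pow]
  simp only [thetaTerm, pow_zero, mul_one]
  rw [neg_add, zpow_add₀ (by norm_num), zpow_neg, zpow_natCast, zpow_neg_one]
  have hs : ((-1 : ℝ) ^ n)⁻¹ = (-1) ^ n := by
    rcases Nat.even_or_odd n with h | h
    · rw [h.neg_one_pow, inv_one]
    · rw [h.neg_one_pow]; norm_num
  rw [hs, Real.sinh_eq]
  push_cast
  have e1 : Real.exp (-K * ((n : ℝ) + 1 / 2) ^ 2 + ((n : ℝ) + 1 / 2) * u) =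
      Real.exp (-(K / 4)) * Real.exp (-K * ((n : ℝ) ^ 2 + n)) *
        Real.exp (((n : ℝ) + 1 / 2) * u) := by
    rw [← Real.exp_add, ← Real.exp_add]; congr 1; ring
  have e2 : Real.exp (-K * (-(n : ℝ) + -1 + 1 / 2) ^ 2 + (-(n : ℝ) + -1 + 1 / 2) * u) =
      Real.exp (-(K / 4)) * Real.exp (-K * ((n : ℝ) ^ 2 + n)) *
        Real.exp (-(((n : ℝ) + 1 / 2) * u)) := by
    rw [← Real.exp_add, ← Real.exp_add]; congr 1; ring
  have e3 : Real.exp (K / 4) * Real.exp (-(K / 4)) = 1 := by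
    rw [← Real.exp_add, add_neg_cancel, Real.exp_zero]
  rw [e1, e2]
  generalize Real.exp (K / 4) = a at *
  generalize Real.exp (-(K / 4)) = b at *
  linear_combination (-(1 / 2) * (-1) ^ n * Real.exp (-K * ((n : ℝ) ^ 2 + n)) *
    (Real.exp (((n : ℝ) + 1 / 2) * u) - Real.exp (-(((n : ℝ) + 1 / 2) * u)))) * e3

theorem hasSum_thetaSeries_one_zero {K : ℝ} (hK : 0 < K) :
    HasSum (fun n : ℕ => (∏ i ∈ Finset.range n, -Real.exp (-(2 * K)) ^ (i + 1)) *
      ((n : ℝ) + 1 / 2)) (Real.exp (K / 4) * thetaSeries 1 0 K / 2) := by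
  have h := ((hasSum_thetaTerm 1 0 hK).nat_add_neg_add_one.mul_left (Real.exp (K / 4))).div_const 2
  refine (congrArg (HasSum · _) (funext fun n => ?_)).mpr h
  rw [prod_neg_exp_pow]
  simp only [thetaTerm, pow_one, mul_zero, add_zero]
  rw [neg_add, zpow_add₀ (by norm_num), zpow_neg, zpow_natCast, zpow_neg_one]
  have hs : ((-1 : ℝ) ^ n)⁻¹ = (-1) ^ n := by
    rcases Nat.even_or_odd n with h | h
    · rw [h.neg_one_pow, inv_one]
    · rw [h.neg_one_pow]; norm_num
  rw [hs]
  push_cast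
  have e1 : Real.exp (-K * ((n : ℝ) + 1 / 2) ^ 2) =
      Real.exp (-(K / 4)) * Real.exp (-K * ((n : ℝ) ^ 2 + n)) := by
    rw [← Real.exp_add]; congr 1; ring
  have e2 : Real.exp (-K * (-(n : ℝ) + -1 + 1 / 2) ^ 2) =
      Real.exp (-(K / 4)) * Real.exp (-K * ((n : ℝ) ^ 2 + n)) := by
    rw [← Real.exp_add]; congr 1; ring
  have e3 : Real.exp (K / 4) * Real.exp (-(K / 4)) = 1 := by
    rw [← Real.exp_add, add_neg_cancel, Real.exp_zero]
  rw [e1, e2]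
  generalize Real.exp (K / 4) = a at *
  generalize Real.exp (-(K / 4)) = b at *
  linear_combination (-(-1) ^ n * Real.exp (-K * ((n : ℝ) ^ 2 + n)) * ((n : ℝ) + 1 / 2)) * e3

theorem tendsto_sum_tripleCoeff_mul {q : ℝ} (hq0 : 0 < q) (hq1 : q < 1) {s : ℕ → ℝ} {a : ℝ}
    (hs : HasSum (fun n : ℕ => (∏ i ∈ Finset.range n, -q ^ (i + 1)) * s n) a) :
    Tendsto (fun N : ℕ => ∑ n ∈ Finset.range (N + 1), tripleCoeff q (q ^ (N + 1)) n * s n) atTop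
      (𝓝 a) := by
  have h (N : ℕ) : ∑ n ∈ Finset.range (N + 1), tripleCoeff q (q ^ (N + 1)) n * s n =
      ∑' n, tripleCoeff q (q ^ (N + 1)) n * s n := by
    rw [tsum_eq_sum]
    intro n hn
    rw [tripleCoeff_eq_zero q (by simpa using hn), zero_mul]
  simp_rw [h]
  rw [← hs.tsum_eq]
  refine tendsto_tsum_of_dominated_convergence hs.summable.abs
    (fun n => (tendsto_tripleCoeff hq0 hq1 n).mul_const _)
    (Eventually.of_forall fun N n => ?_)
  rw [Real.norm_eq_abs, abs_mul, abs_mul]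
  exact mul_le_mul_of_nonneg_right (abs_tripleCoeff_le hq0 hq1 N n) (abs_nonneg _)

/-- The `u`-derivative at `0` of the finite triple product. -/
theorem finite_triple_product_deriv {q : ℝ} (hq0 : 0 < q) (hq1 : q < 1) (N : ℕ) :
    (∏ k ∈ Finset.range N, (1 - q ^ (k + 1)) ^ 2) / 2 =
      (∏ k ∈ Finset.range N, tripleFactor q (q ^ (k + 1))) *
        ∑ n ∈ Finset.range (N + 1), tripleCoeff q (q ^ (N + 1)) n * ((n : ℝ) + 1 / 2) := by
  have hl (x : ℝ) : HasDerivAt (fun u : ℝ => Real.sinh (x * u)) x 0 := by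
    have := ((hasDerivAt_id (0 : ℝ)).const_mul x).sinh
    simpa using this
  have hP : DifferentiableAt ℝ (fun u : ℝ => ∏ k ∈ Finset.range N,
      (1 - 2 * q ^ (k + 1) * Real.cosh u + (q ^ (k + 1)) ^ 2)) 0 := by fun_prop
  have h1 := (hl (1 / 2)).mul hP.hasDerivAt
  have h2 := (HasDerivAt.fun_sum (u := Finset.range (N + 1)) fun n _ =>
    (hl ((n : ℝ) + 1 / 2)).const_mul (tripleCoeff q (q ^ (N + 1)) n)).const_mul
      (∏ k ∈ Finset.range N, tripleFactor q (q ^ (k + 1)))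
  have h3 := h1.unique (h2.congr_of_eventuallyEq (Eventually.of_forall fun u => by
    have := finite_triple_product hq0 hq1 u N
    rw [show u / 2 = 1 / 2 * u by ring] at this
    exact this))
  rw [← h3]
  simp only [mul_zero, Real.sinh_zero, zero_mul, add_zero, Real.cosh_zero]
  rw [div_eq_mul_one_div, mul_comm]
  congr 1
  exact Finset.prod_congr rfl fun k _ => by ring

theorem exp_neg_two_mul_mem_Ioo {K : ℝ} (hK : 0 < K) : Real.exp (-(2 * K)) ∈ Ioo (0 : ℝ) 1 :=
  ⟨Real.exp_pos _, Real.exp_lt_one_iff.mpr (by linarith)⟩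

theorem thetaSeries_one_zero_pos {K : ℝ} (hK : 0 < K) : 0 < thetaSeries 1 0 K := by
  obtain ⟨hq0, hq1⟩ := exp_neg_two_mul_mem_Ioo hK
  have hlim := tendsto_sum_tripleCoeff_mul hq0 hq1 (hasSum_thetaSeries_one_zero hK)
  set q := Real.exp (-(2 * K))
  have hQ (k : ℕ) : 0 < q ^ (k + 1) ∧ q ^ (k + 1) < 1 :=
    ⟨pow_pos hq0 _, pow_lt_one₀ hq0.le hq1 (Nat.succ_ne_zero k)⟩
  obtain ⟨δ, hδ, hδN⟩ := exists_pos_le_prod_one_sub (x := fun k => q ^ (k + 1))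
    (fun k => (hQ k).1.le) (fun k => (hQ k).2)
    ((summable_nat_add_iff 1).mpr (summable_geometric_of_lt_one hq0.le hq1))
  obtain ⟨ε, hε, hεN⟩ := exists_pos_le_prod_one_sub (x := fun k => q * q ^ (k + 1))
    (fun k => (mul_pos hq0 (hQ k).1).le) (fun k => by nlinarith [hQ k])
    (((summable_nat_add_iff 1).mpr (summable_geometric_of_lt_one hq0.le hq1)).mul_left q)
  have hbound (N : ℕ) : δ ^ 3 * ε / 2 ≤ ∑ n ∈ Finset.range (N + 1),
      tripleCoeff q (q ^ (N + 1)) n * ((n : ℝ) + 1 / 2) := by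
    have h1 := finite_triple_product_deriv hq0 hq1 N
    have hβ : 0 < ∏ k ∈ Finset.range N, tripleFactor q (q ^ (k + 1)) :=
      Finset.prod_pos fun k _ => tripleFactor_pos hq0 hq1 (hQ k).1 (hQ k).2
    have hβ1 : (∏ k ∈ Finset.range N, tripleFactor q (q ^ (k + 1))) *
        ((∏ k ∈ Finset.range N, (1 - q ^ (k + 1))) *
          ∏ k ∈ Finset.range N, (1 - q * q ^ (k + 1))) ≤ 1 := by
      rw [← Finset.prod_mul_distrib, ← Finset.prod_mul_distrib]
      refine Finset.prod_le_one (fun k _ => ?_)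
        fun k _ => tripleFactor_mul_le hq0 hq1 (hQ k).1 (hQ k).2
      have h2 := tripleFactor_pos hq0 hq1 (hQ k).1 (hQ k).2
      have h3 : 0 ≤ 1 - q * q ^ (k + 1) := by nlinarith [hQ k]
      have h4 : 0 ≤ 1 - q ^ (k + 1) := by linarith [hQ k]
      positivity
    rw [Finset.prod_pow] at h1
    have hA := hδN N
    have hB := hεN N
    generalize (∏ k ∈ Finset.range N, tripleFactor q (q ^ (k + 1))) = β at *
    generalize (∏ k ∈ Finset.range N, (1 - q ^ (k + 1))) = A at *
    generalize (∏ k ∈ Finset.range N, (1 - q * q ^ (k + 1))) = B at *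
    generalize (∑ n ∈ _, _ : ℝ) = s at *
    have hA0 := hδ.trans_le hA
    have hB0 := hε.trans_le hB
    have h5 : δ ^ 3 * ε ≤ A ^ 3 * B := by gcongr
    have h6 : β * (A ^ 3 * B / 2) ≤ β * s := by
      rw [← h1]
      have : β * (A * B) * (A ^ 2 / 2) ≤ 1 * (A ^ 2 / 2) := by gcongr
      linarith
    linarith [le_of_mul_le_mul_left h6 hβ]
  have h7 := ge_of_tendsto' hlim hbound
  have h8 : 0 < Real.exp (K / 4) * thetaSeries 1 0 K := by
    have : 0 < δ ^ 3 * ε / 2 := by positivity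
    linarith
  exact (pos_iff_pos_of_mul_pos h8).mp (Real.exp_pos _)

theorem one_sub_exp_sq_mul_one_sub_div_sinh_sq (u : ℝ) {y : ℝ} (hy : 0 < y) :
    1 - 2 * Real.exp (-(2 * y)) * Real.cosh u + Real.exp (-(2 * y)) ^ 2 =
      (1 - Real.exp (-(2 * y))) ^ 2 * (1 - Real.sinh (u / 2) ^ 2 / Real.sinh y ^ 2) := by
  have h1 : Real.cosh u = 1 + 2 * Real.sinh (u / 2) ^ 2 := by
    have h := Real.cosh_two_mul (u / 2)
    rw [mul_div_cancel₀ _ two_ne_zero, Real.cosh_sq] at h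
    linarith
  have h2 : (1 - Real.exp (-(2 * y))) ^ 2 = 4 * Real.exp (-(2 * y)) * Real.sinh y ^ 2 := by
    have h3 : Real.exp (-(2 * y)) = Real.exp (-y) * Real.exp (-y) := by
      rw [← Real.exp_add]; congr 1; ring
    have h4 : Real.exp (-y) * Real.exp y = 1 := by
      rw [← Real.exp_add, neg_add_cancel, Real.exp_zero]
    rw [h3, Real.sinh_eq]
    generalize Real.exp (-y) = a at *
    generalize Real.exp y = b at *
    linear_combination (2 * a ^ 2 - a * b - 1) * h4
  have hs : Real.sinh y ^ 2 ≠ 0 := (pow_pos (Real.sinh_pos_iff.mpr hy) 2).ne'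
  rw [mul_sub, mul_one, h1]
  nth_rewrite 2 [h2]
  field_simp
  ring

/-- The product formula for the odd theta function, normalised by its derivative at `0`. -/
theorem tendsto_prod_thetaSeries (u : ℝ) {K : ℝ} (hK : 0 < K) :
    Tendsto (fun N : ℕ => 2 * Real.sinh (u / 2) *
      ∏ k ∈ Finset.range N, (1 - Real.sinh (u / 2) ^ 2 / Real.sinh (((k : ℝ) + 1) * K) ^ 2))
      atTop (𝓝 (thetaSeries 0 u K / thetaSeries 1 0 K)) := by
  obtain ⟨hq0, hq1⟩ := exp_neg_two_mul_mem_Ioo hK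
  have hlim := (tendsto_sum_tripleCoeff_mul hq0 hq1 (hasSum_sinh_thetaSeries u hK)).div
    (tendsto_sum_tripleCoeff_mul hq0 hq1 (hasSum_thetaSeries_one_zero hK))
    (by have := thetaSeries_one_zero_pos hK; positivity)
  rw [div_div_div_cancel_right₀ two_ne_zero, mul_div_mul_left _ _ (Real.exp_pos _).ne'] at hlim
  refine hlim.congr fun N => ?_
  rw [Pi.div_apply]
  have h1 := finite_triple_product hq0 hq1 u N
  have h2 := finite_triple_product_deriv hq0 hq1 N
  have hβ : 0 < ∏ k ∈ Finset.range N,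
      tripleFactor (Real.exp (-(2 * K))) (Real.exp (-(2 * K)) ^ (k + 1)) :=
    Finset.prod_pos fun k _ => tripleFactor_pos hq0 hq1 (pow_pos hq0 _)
      (pow_lt_one₀ hq0.le hq1 (Nat.succ_ne_zero k))
  have hA : 0 < ∏ k ∈ Finset.range N, (1 - Real.exp (-(2 * K)) ^ (k + 1)) ^ 2 :=
    Finset.prod_pos fun k _ => pow_pos (sub_pos.mpr
      (pow_lt_one₀ hq0.le hq1 (Nat.succ_ne_zero k))) 2
  have h3 : ∏ k ∈ Finset.range N, (1 - 2 * Real.exp (-(2 * K)) ^ (k + 1) * Real.cosh u +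
      (Real.exp (-(2 * K)) ^ (k + 1)) ^ 2) =
      (∏ k ∈ Finset.range N, (1 - Real.exp (-(2 * K)) ^ (k + 1)) ^ 2) *
      ∏ k ∈ Finset.range N, (1 - Real.sinh (u / 2) ^ 2 / Real.sinh (((k : ℝ) + 1) * K) ^ 2) := by
    rw [← Finset.prod_mul_distrib]
    refine Finset.prod_congr rfl fun k _ => ?_
    rw [← Real.exp_nat_mul, show ((k + 1 : ℕ) : ℝ) * -(2 * K) = -(2 * (((k : ℝ) + 1) * K)) by
      push_cast; ring]
    exact one_sub_exp_sq_mul_one_sub_div_sinh_sq u (by positivity)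
  rw [h3] at h1
  generalize (∏ k ∈ Finset.range N, (1 - Real.exp (-(2 * K)) ^ (k + 1)) ^ 2) = A at *
  generalize (∏ k ∈ Finset.range N,
      tripleFactor (Real.exp (-(2 * K))) (Real.exp (-(2 * K)) ^ (k + 1))) = β at *
  generalize (∏ k ∈ Finset.range N,
    (1 - Real.sinh (u / 2) ^ 2 / Real.sinh (((k : ℝ) + 1) * K) ^ 2)) = P at *
  have hS : ∑ n ∈ Finset.range (N + 1), tripleCoeff (Real.exp (-(2 * K)))
      (Real.exp (-(2 * K)) ^ (N + 1)) n * ((n : ℝ) + 1 / 2) ≠ 0 := by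
    intro h0
    rw [h0] at h2
    linarith
  rw [div_eq_iff hS]
  refine mul_left_cancel₀ hβ.ne' ?_
  linear_combination (-1 : ℝ) * h1 + 2 * Real.sinh (u / 2) * P * h2

/-! ### The theta quotient in real variables -/

theorem jacobiTheta₂_eq_thetaSeries (t K : ℝ) :
    jacobiTheta₂ ((K * (2 * t + 1) : ℝ) / (2 * π * Complex.I) + 1 / 2) (Complex.I * K / π) =
      -((Real.exp (K / 4 + K * t) * thetaSeries 0 (2 * K * t) K : ℝ) : ℂ) := by
  have hπ : (π : ℂ) ≠ 0 := by exact_mod_cast Real.pi_ne_zero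
  rw [thetaSeries, ← tsum_mul_left, ← (Equiv.subRight (1 : ℤ)).tsum_eq, Complex.ofReal_tsum,
    ← tsum_neg, jacobiTheta₂]
  congr 1
  funext n
  have hn : Complex.exp (n * (π * Complex.I)) = (-1 : ℂ) ^ n := by
    rw [Complex.exp_int_mul, Complex.exp_pi_mul_I]
  have h1 : 2 * π * Complex.I * n *
      ((K * (2 * t + 1) : ℝ) / (2 * π * Complex.I) + 1 / 2) +
      π * Complex.I * n ^ 2 * (Complex.I * K / π) =
      n * (π * Complex.I) + ((K / 4 + K * t) + (-K * ((n - 1 : ℂ) + 1 / 2) ^ 2 +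
        ((n - 1 : ℂ) + 1 / 2) * (2 * K * t))) := by
    have hI := Complex.I_ne_zero
    push_cast
    field_simp
    linear_combination (16 * (n : ℂ) ^ 2 * K) * Complex.I_sq
  rw [jacobiTheta₂_term, h1, Complex.exp_add, Complex.exp_add, hn]
  simp only [thetaTerm, Equiv.subRight_apply, pow_zero, mul_one]
  push_cast
  rw [zpow_sub_one₀ (by norm_num)]
  norm_num
  ring

/-- On the imaginary axis `ϑ₁₁` is, up to a Gaussian factor and a constant, the real theta series:
this is Jacobi's imaginary transformation. -/
theorem theta11_eq_thetaSeries {K : ℝ} (hK : 0 < K) : ∃ C : ℂ, C ≠ 0 ∧ ∀ t : ℝ,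
    theta11 t (Complex.I * π / K) =
      C * ((Real.exp (-K * t ^ 2) * thetaSeries 0 (2 * K * t) K : ℝ) : ℂ) := by
  have hK' : (K : ℂ) ≠ 0 := by exact_mod_cast hK.ne'
  have hπ : (π : ℂ) ≠ 0 := by exact_mod_cast Real.pi_ne_zero
  have hI := Complex.I_ne_zero
  obtain ⟨τ, hτ⟩ : ∃ τ : ℂ, τ = Complex.I * π / K := ⟨_, rfl⟩
  have hτ0 : τ ≠ 0 := by
    rw [hτ]; exact div_ne_zero (mul_ne_zero hI hπ) hK'
  have hKτ : K * τ = Complex.I * π := by rw [hτ]; field_simp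
  refine ⟨-(Complex.I * (1 / (-Complex.I * τ) ^ (1 / 2 : ℂ)) *
    Complex.exp (Complex.I * π * τ / 4 + K / 4 - K * (1 + τ) ^ 2 / 4)), ?_, fun t => ?_⟩
  · refine neg_ne_zero.mpr (mul_ne_zero (mul_ne_zero hI (one_div_ne_zero ?_))
      (Complex.exp_ne_zero _))
    rw [Complex.cpow_ne_zero_iff]
    exact Or.inl (mul_ne_zero (neg_ne_zero.mpr hI) hτ0)
  · rw [← hτ, theta11, jacobiTheta₂_functional_equation]
    have h1 : ((t : ℂ) + (1 + τ) / 2) / τ =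
        (K * (2 * t + 1) : ℝ) / (2 * π * Complex.I) + 1 / 2 := by
      rw [hτ]
      push_cast
      field_simp
      ring
    have h2 : -1 / τ = Complex.I * K / π := by
      rw [hτ]
      field_simp
      linear_combination -Complex.I_sq
    have h3 : -π * Complex.I * ((t : ℂ) + (1 + τ) / 2) ^ 2 / τ =
        -K * ((t : ℂ) + (1 + τ) / 2) ^ 2 := by
      rw [div_eq_iff hτ0]
      linear_combination ((t : ℂ) + (1 + τ) / 2) ^ 2 * hKτ
    rw [h1, h2, h3, jacobiTheta₂_eq_thetaSeries t K]
    push_cast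
    have h4 : Complex.exp (Complex.I * π * (t + τ / 4)) *
        Complex.exp (-K * ((t : ℂ) + (1 + τ) / 2) ^ 2) * Complex.exp (K / 4 + K * t) =
        Complex.exp (Complex.I * π * τ / 4 + K / 4 - K * (1 + τ) ^ 2 / 4) *
          Complex.exp (-K * t ^ 2) := by
      rw [← Complex.exp_add, ← Complex.exp_add, ← Complex.exp_add]
      congr 1
      linear_combination (-(t : ℂ)) * hKτ
    linear_combination (-Complex.I * (1 / (-Complex.I * τ) ^ (1 / 2 : ℂ)) *
      thetaSeries 0 (2 * K * t) K) * h4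

theorem calU_eq_thetaSeries (η : ℝ) {K : ℝ} (hK : 0 < K) :
    calU η K = Real.exp (-(η / 2)) * (thetaSeries 0 η K / thetaSeries 1 0 K) := by
  obtain ⟨C, hC, h⟩ := theta11_eq_thetaSeries hK
  have hd1 := thetaSeries_one_zero_pos hK
  have him : 0 < (Complex.I * π / K).im := by
    rw [mul_div_assoc, Complex.I_mul_im, ← Complex.ofReal_div, Complex.ofReal_re]
    positivity
  have hdiff : DifferentiableAt ℂ (fun z : ℂ => theta11 z (Complex.I * π / K)) 0 := by
    unfold theta11
    refine DifferentiableAt.mul (by fun_prop) ?_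
    exact (differentiableAt_jacobiTheta₂_fst _ him).comp (0 : ℂ) (by fun_prop)
  have hreal : HasDerivAt (fun t : ℝ => Real.exp (-K * t ^ 2) * thetaSeries 0 (2 * K * t) K)
      (2 * K * thetaSeries 1 0 K) 0 := by
    have h1 : HasDerivAt (fun t : ℝ => Real.exp (-K * t ^ 2)) 0 0 := by
      have := (((hasDerivAt_id (0 : ℝ)).pow 2).const_mul (-K)).exp
      simpa using this
    have h2 : HasDerivAt (fun t : ℝ => thetaSeries 0 (2 * K * t) K)
        (thetaSeries 1 0 K * (2 * K)) 0 := by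
      refine HasDerivAt.comp (0 : ℝ) (h₂ := fun v => thetaSeries 0 v K) ?_
        (by simpa using (hasDerivAt_id (0 : ℝ)).const_mul (2 * K))
      rw [mul_zero]
      exact hasDerivAt_thetaSeries_left 0 0 hK
    refine (h1.mul h2).congr_deriv ?_
    simp
    ring
  have hderiv : deriv (fun z : ℂ => theta11 z (Complex.I * π / K)) 0 =
      C * ((2 * K * thetaSeries 1 0 K : ℝ) : ℂ) := by
    have h1 : HasDerivAt (fun t : ℝ => theta11 t (Complex.I * π / K))
        (deriv (fun z : ℂ => theta11 z (Complex.I * π / K)) 0) 0 :=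
      HasDerivAt.comp_ofReal (e := fun z : ℂ => theta11 z (Complex.I * π / K))
        (by rw [Complex.ofReal_zero]; exact hdiff.hasDerivAt)
    refine h1.unique ?_
    simp_rw [h]
    exact hreal.ofReal_comp.const_mul C
  unfold calU theta11Ratio
  rw [hderiv, h, mul_div_mul_left _ _ hC, ← Complex.ofReal_div, Complex.ofReal_re,
    show 2 * K * (η / (2 * K)) = η by field_simp]
  have he : Real.exp (η / 2 * (η / (2 * K) - 1)) * Real.exp (-K * (η / (2 * K)) ^ 2) =
      Real.exp (-(η / 2)) := by
    rw [← Real.exp_add]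
    congr 1
    field_simp
    ring
  rw [← he]
  field_simp

/-! ### Concavity -/

/-- The `k`-th factor (counted from `0`) of the product formula for `𝒰`. -/
noncomputable def sinhFactor (η : ℝ) (k : ℕ) (K : ℝ) : ℝ :=
  1 - Real.sinh (η / 2) ^ 2 / Real.sinh (((k : ℝ) + 1) * K) ^ 2

/-- The logarithmic `K`-derivative of `sinhFactor`. -/
noncomputable def sinhFactorLog (η : ℝ) (k : ℕ) (K : ℝ) : ℝ :=
  2 * ((k : ℝ) + 1) * Real.sinh (η / 2) ^ 2 * Real.cosh (((k : ℝ) + 1) * K) /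
    (Real.sinh (((k : ℝ) + 1) * K) *
      (Real.sinh (((k : ℝ) + 1) * K) ^ 2 - Real.sinh (η / 2) ^ 2))

/-- Minus the quotient of the second and the first derivative of `- 1 / sinh ²`. -/
noncomputable def curvatureRatio (y : ℝ) : ℝ :=
  (2 * Real.sinh y ^ 2 + 3) / (Real.sinh y * Real.cosh y)

theorem sinh_half_lt_sinh {η : ℝ} (hη : 0 < η) {K : ℝ} (hK : η / 2 < K) (k : ℕ) :
    0 < Real.sinh (η / 2) ∧ Real.sinh (η / 2) < Real.sinh (((k : ℝ) + 1) * K) := by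
  refine ⟨Real.sinh_pos_iff.mpr (by linarith), Real.sinh_lt_sinh.mpr (hK.trans_le ?_)⟩
  have : 0 ≤ (k : ℝ) * K := mul_nonneg k.cast_nonneg (by linarith)
  linarith

theorem sinhFactor_mem {η : ℝ} (hη : 0 < η) {K : ℝ} (hK : η / 2 < K) (k : ℕ) :
    0 < sinhFactor η k K ∧ sinhFactor η k K < 1 := by
  obtain ⟨h1, h2⟩ := sinh_half_lt_sinh hη hK k
  unfold sinhFactor
  have h3 : 0 < Real.sinh (((k : ℝ) + 1) * K) ^ 2 := by have := h1.trans h2; positivity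
  have h4 : Real.sinh (η / 2) ^ 2 / Real.sinh (((k : ℝ) + 1) * K) ^ 2 < 1 := by
    rw [div_lt_one h3]; gcongr
  have h5 : 0 < Real.sinh (η / 2) ^ 2 / Real.sinh (((k : ℝ) + 1) * K) ^ 2 := by positivity
  constructor <;> linarith

theorem sinhFactorLog_pos {η : ℝ} (hη : 0 < η) {K : ℝ} (hK : η / 2 < K) (k : ℕ) :
    0 < sinhFactorLog η k K := by
  obtain ⟨h1, h2⟩ := sinh_half_lt_sinh hη hK k
  unfold sinhFactorLog
  have h3 : 0 < Real.sinh (((k : ℝ) + 1) * K) ^ 2 - Real.sinh (η / 2) ^ 2 := by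
    rw [sub_pos]; gcongr
  have h4 := h1.trans h2
  have h5 := Real.cosh_pos (((k : ℝ) + 1) * K)
  positivity

theorem hasDerivAt_sinhFactor {η : ℝ} (hη : 0 < η) {K : ℝ} (hK : η / 2 < K) (k : ℕ) :
    HasDerivAt (sinhFactor η k) (sinhFactor η k K * sinhFactorLog η k K) K := by
  obtain ⟨h1, h2⟩ := sinh_half_lt_sinh hη hK k
  have h3 : Real.sinh (((k : ℝ) + 1) * K) ^ 2 - Real.sinh (η / 2) ^ 2 ≠ 0 := by
    refine (sub_pos.mpr ?_).ne'; gcongr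
  have h4 := (h1.trans h2).ne'
  have hl : HasDerivAt (fun K : ℝ => ((k : ℝ) + 1) * K) ((k : ℝ) + 1) K := by
    simpa using (hasDerivAt_id K).const_mul ((k : ℝ) + 1)
  have h := (((hl.sinh.pow 2).inv (pow_ne_zero 2 h4)).const_mul (Real.sinh (η / 2) ^ 2)).const_sub 1
  refine h.congr_deriv ?_
  unfold sinhFactor sinhFactorLog
  simp only [Pi.pow_apply]
  field_simp
  ring

theorem hasDerivAt_sinhFactorLog {η : ℝ} (hη : 0 < η) {K : ℝ} (hK : η / 2 < K) (k : ℕ) :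
    HasDerivAt (sinhFactorLog η k) (-(((k : ℝ) + 1) * curvatureRatio (((k : ℝ) + 1) * K) *
      sinhFactorLog η k K) - sinhFactorLog η k K ^ 2) K := by
  obtain ⟨h1, h2⟩ := sinh_half_lt_sinh hη hK k
  have h3 : Real.sinh (((k : ℝ) + 1) * K) ^ 2 - Real.sinh (η / 2) ^ 2 ≠ 0 := by
    refine (sub_pos.mpr ?_).ne'; gcongr
  have h4 := (h1.trans h2).ne'
  have h5 := (Real.cosh_pos (((k : ℝ) + 1) * K)).ne'
  have hl : HasDerivAt (fun K : ℝ => ((k : ℝ) + 1) * K) ((k : ℝ) + 1) K := by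
    simpa using (hasDerivAt_id K).const_mul ((k : ℝ) + 1)
  have h := (hl.cosh.const_mul (2 * ((k : ℝ) + 1) * Real.sinh (η / 2) ^ 2)).div
    (hl.sinh.mul ((hl.sinh.pow 2).sub_const (Real.sinh (η / 2) ^ 2))) (mul_ne_zero h4 h3)
  refine h.congr_deriv ?_
  unfold curvatureRatio sinhFactorLog
  simp only [Pi.pow_apply, Pi.mul_apply, Nat.cast_ofNat, Nat.add_one_sub_one, pow_one]
  have hc : Real.cosh (((k : ℝ) + 1) * K) ^ 2 = Real.sinh (((k : ℝ) + 1) * K) ^ 2 + 1 :=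
    Real.cosh_sq _
  generalize Real.cosh (((k : ℝ) + 1) * K) = c at *
  generalize Real.sinh (((k : ℝ) + 1) * K) = s at *
  generalize Real.sinh (η / 2) = x at *
  generalize (k : ℝ) + 1 = n at *
  field_simp
  rw [hc]
  ring

theorem sinh_le_mul_cosh {y : ℝ} (hy : 0 ≤ y) : Real.sinh y ≤ y * Real.cosh y := by
  have hd (x : ℝ) : HasDerivAt (fun x : ℝ => x * Real.cosh x - Real.sinh x) (x * Real.sinh x) x := by
    refine (((hasDerivAt_id x).mul (Real.hasDerivAt_cosh x)).sub
      (Real.hasDerivAt_sinh x)).congr_deriv ?_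
    simp
  have hm : MonotoneOn (fun x : ℝ => x * Real.cosh x - Real.sinh x) (Ici 0) := by
    refine monotoneOn_of_deriv_nonneg (convex_Ici 0)
      (fun x _ => (hd x).continuousAt.continuousWithinAt)
      (fun x _ => (hd x).differentiableAt.differentiableWithinAt) fun x hx => ?_
    rw [interior_Ici] at hx
    rw [(hd x).deriv]
    exact mul_nonneg (le_of_lt hx) (Real.sinh_nonneg_iff.mpr (le_of_lt hx))
  have := hm self_mem_Ici hy hy
  simp only [zero_mul, Real.sinh_zero, sub_zero] at this
  linarith

theorem two_le_mul_curvatureRatio {y : ℝ} (hy : 0 < y) : 2 ≤ y * curvatureRatio y := by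
  have hs := Real.sinh_pos_iff.mpr hy
  have hc := Real.cosh_pos y
  unfold curvatureRatio
  rw [← mul_div_assoc, le_div_iff₀ (by positivity)]
  have h1 := mul_le_mul_of_nonneg_right (sinh_le_mul_cosh hy.le) hc.le
  have h2 := Real.cosh_sq y
  nlinarith

/-- Summation by parts. It is used with `C m = coth (m K)`, where the terms on the left are the
logarithmic derivatives `sinhFactorLog` at the extreme value `η = 2 K`. -/
theorem sum_coth_second_difference {C : ℕ → ℝ} (N : ℕ) :
    ∑ k ∈ Finset.range N, ((k : ℝ) + 2) * (C (k + 3) + C (k + 1) - 2 * C (k + 2)) =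
      2 * C 1 - C 2 + ((N : ℝ) + 1) * C (N + 2) - ((N : ℝ) + 2) * C (N + 1) := by
  induction N with
  | zero => simp
  | succ N ih =>
    rw [Finset.sum_range_succ, ih]
    push_cast
    ring

theorem sinhFactorLog_le {η : ℝ} (hη : 0 < η) {K : ℝ} (hK : η / 2 < K) (k : ℕ) :
    sinhFactorLog η (k + 1) K ≤ ((k : ℝ) + 2) *
      (Real.cosh (((k : ℝ) + 3) * K) / Real.sinh (((k : ℝ) + 3) * K) +
        Real.cosh (((k : ℝ) + 1) * K) / Real.sinh (((k : ℝ) + 1) * K) -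
        2 * (Real.cosh (((k : ℝ) + 2) * K) / Real.sinh (((k : ℝ) + 2) * K))) := by
  have hK0 : 0 < K := by linarith
  obtain ⟨h1, h2⟩ := sinh_half_lt_sinh hη hK 0
  rw [Nat.cast_zero, zero_add, one_mul] at h2
  have h3 := Real.sinh_pos_iff.mpr (show 0 < ((k : ℝ) + 3) * K by positivity)
  have h4 := Real.sinh_pos_iff.mpr (show 0 < ((k : ℝ) + 1) * K by positivity)
  have h5 := Real.sinh_pos_iff.mpr (show 0 < ((k : ℝ) + 2) * K by positivity)
  have hc := Real.cosh_pos (((k : ℝ) + 2) * K)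
  unfold sinhFactorLog
  rw [show (((k + 1 : ℕ) : ℝ) + 1) = (k : ℝ) + 2 by push_cast; ring]
  have e1 : Real.sinh (((k : ℝ) + 3) * K) = Real.sinh (((k : ℝ) + 2) * K) * Real.cosh K +
      Real.cosh (((k : ℝ) + 2) * K) * Real.sinh K := by
    rw [← Real.sinh_add]; congr 1; ring
  have e2 : Real.sinh (((k : ℝ) + 1) * K) = Real.sinh (((k : ℝ) + 2) * K) * Real.cosh K -
      Real.cosh (((k : ℝ) + 2) * K) * Real.sinh K := by
    rw [← Real.sinh_sub]; congr 1; ring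
  have e3 : Real.cosh (((k : ℝ) + 3) * K) = Real.cosh (((k : ℝ) + 2) * K) * Real.cosh K +
      Real.sinh (((k : ℝ) + 2) * K) * Real.sinh K := by
    rw [← Real.cosh_add]; congr 1; ring
  have e4 : Real.cosh (((k : ℝ) + 1) * K) = Real.cosh (((k : ℝ) + 2) * K) * Real.cosh K -
      Real.sinh (((k : ℝ) + 2) * K) * Real.sinh K := by
    rw [← Real.cosh_sub]; congr 1; ring
  have e5 := Real.cosh_sq K
  have e6 := Real.cosh_sq (((k : ℝ) + 2) * K)
  rw [e3, e4]
  have e7 : Real.sinh (((k : ℝ) + 2) * K) ^ 2 - Real.sinh K ^ 2 =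
      Real.sinh (((k : ℝ) + 3) * K) * Real.sinh (((k : ℝ) + 1) * K) := by
    rw [e1, e2]
    linear_combination (-Real.sinh (((k : ℝ) + 2) * K) ^ 2) * e5 + Real.sinh K ^ 2 * e6
  have hk : (0 : ℝ) < (k : ℝ) + 2 := by positivity
  generalize hS3 : Real.sinh (((k : ℝ) + 3) * K) = S3 at *
  generalize hS1 : Real.sinh (((k : ℝ) + 1) * K) = S1 at *
  generalize Real.sinh (((k : ℝ) + 2) * K) = s at *
  generalize Real.cosh (((k : ℝ) + 2) * K) = c at *
  generalize Real.sinh K = t at *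
  generalize Real.cosh K = d at *
  generalize Real.sinh (η / 2) = x at *
  have hst : 0 < s ^ 2 - t ^ 2 := by rw [e7]; positivity
  have hx : x ^ 2 ≤ t ^ 2 := by gcongr
  have hrhs : (c * d + s * t) / S3 + (c * d - s * t) / S1 - 2 * (c / s) =
      2 * t ^ 2 * c / (s * (s ^ 2 - t ^ 2)) := by
    rw [e7]
    field_simp
    rw [e1, e2]
    linear_combination (2 * c * t ^ 2) * e6
  rw [hrhs, ← mul_div_assoc]
  apply div_le_div₀ (by positivity) (by nlinarith [mul_pos hk hc]) (by positivity)
  gcongr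

theorem sum_sinhFactorLog_le {η : ℝ} (hη : 0 < η) {K : ℝ} (hK : η / 2 < K) (N : ℕ) :
    ∑ k ∈ Finset.range N, sinhFactorLog η (k + 1) K ≤
      2 * (Real.cosh K / Real.sinh K) - Real.cosh (2 * K) / Real.sinh (2 * K) - 1 := by
  have hK0 : 0 < K := by linarith
  have h := Finset.sum_le_sum fun k (_ : k ∈ Finset.range N) => sinhFactorLog_le hη hK k
  have h2 := sum_coth_second_difference
    (C := fun m : ℕ => Real.cosh ((m : ℝ) * K) / Real.sinh ((m : ℝ) * K)) N
  push_cast at h2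
  rw [one_mul] at h2
  refine h.trans (h2.trans_le ?_)
  have h3 := Real.sinh_pos_iff.mpr (show 0 < ((N : ℝ) + 1) * K by positivity)
  have h4 := Real.sinh_pos_iff.mpr (show 0 < ((N : ℝ) + 2) * K by positivity)
  have h5 := Real.sinh_lt_cosh (((N : ℝ) + 1) * K)
  have h6 : 1 ≤ Real.cosh (((N : ℝ) + 1) * K) / Real.sinh (((N : ℝ) + 1) * K) := by
    rw [one_le_div h3]; exact h5.le
  have h7 : Real.cosh (((N : ℝ) + 2) * K) / Real.sinh (((N : ℝ) + 2) * K) ≤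
      Real.cosh (((N : ℝ) + 1) * K) / Real.sinh (((N : ℝ) + 1) * K) := by
    rw [div_le_div_iff₀ h4 h3]
    have h8 := Real.sinh_sub (((N : ℝ) + 2) * K) (((N : ℝ) + 1) * K)
    rw [show ((N : ℝ) + 2) * K - ((N : ℝ) + 1) * K = K by ring] at h8
    have := Real.sinh_pos_iff.mpr hK0
    linarith
  have h9 : 0 ≤ (N : ℝ) + 1 := by positivity
  nlinarith

theorem two_mul_coth_sub_coth {K : ℝ} (hK : 0 < K) :
    2 * (Real.cosh K / Real.sinh K) - Real.cosh (2 * K) / Real.sinh (2 * K) =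
      curvatureRatio K / 2 := by
  have hs := (Real.sinh_pos_iff.mpr hK).ne'
  have hc := (Real.cosh_pos K).ne'
  unfold curvatureRatio
  rw [Real.cosh_two_mul, Real.sinh_two_mul]
  have := Real.cosh_sq K
  field_simp
  linear_combination 3 * this

theorem two_mul_coth_sub_coth_le {K : ℝ} (hK : 0 < K) :
    2 * (Real.cosh K / Real.sinh K) - Real.cosh (2 * K) / Real.sinh (2 * K) - 1 ≤ 2 / K := by
  have hs := Real.sinh_pos_iff.mpr hK
  have hs2 := Real.sinh_pos_iff.mpr (show 0 < 2 * K by linarith)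
  have h1 : 1 ≤ Real.cosh (2 * K) / Real.sinh (2 * K) := by
    rw [one_le_div hs2]; exact (Real.sinh_lt_cosh _).le
  have h2 : Real.cosh K / Real.sinh K ≤ 1 + 1 / K := by
    rw [div_le_iff₀ hs]
    have h3 := Real.self_le_sinh_iff.mpr hK.le
    have h4 := Real.cosh_sub_sinh K
    have h5 : Real.exp (-K) ≤ 1 := Real.exp_le_one_iff.mpr (by linarith)
    have h6 : 1 ≤ 1 / K * Real.sinh K := by
      rw [one_div, inv_mul_eq_div, one_le_div hK]; exact h3
    linarith
  have h7 : 2 / K = 2 * (1 / K) := by ring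
  linarith

/-- The second logarithmic derivative of the partial products is controlled by the first factor. -/
theorem sum_sinhFactorLog_sq_add_le {η : ℝ} (hη : 0 < η) {K : ℝ} (hK : η / 2 < K) (N : ℕ) :
    (∑ k ∈ Finset.range (N + 1), sinhFactorLog η k K) ^ 2 +
      ∑ k ∈ Finset.range (N + 1), (-(((k : ℝ) + 1) * curvatureRatio (((k : ℝ) + 1) * K) *
        sinhFactorLog η k K) - sinhFactorLog η k K ^ 2) ≤ -2 * sinhFactorLog η 0 K := by
  have hK0 : 0 < K := by linarith
  have hH := sum_sinhFactorLog_le hη hK N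
  have hH2 := hH.trans (two_mul_coth_sub_coth_le hK0)
  rw [two_mul_coth_sub_coth hK0] at hH
  rw [Finset.sum_range_succ', Finset.sum_range_succ']
  have hg0 := sinhFactorLog_pos hη hK 0
  have hle : ∑ k ∈ Finset.range N, (-((((k + 1 : ℕ) : ℝ) + 1) *
      curvatureRatio ((((k + 1 : ℕ) : ℝ) + 1) * K) *
        sinhFactorLog η (k + 1) K) - sinhFactorLog η (k + 1) K ^ 2) ≤
      ∑ k ∈ Finset.range N, -(2 / K) * sinhFactorLog η (k + 1) K := by
    refine Finset.sum_le_sum fun k _ => ?_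
    have h1 := two_le_mul_curvatureRatio (show 0 < (((k + 1 : ℕ) : ℝ) + 1) * K by positivity)
    have h2 : 2 / K ≤ (((k + 1 : ℕ) : ℝ) + 1) * curvatureRatio ((((k + 1 : ℕ) : ℝ) + 1) * K) := by
      rw [div_le_iff₀ hK0]; linarith
    have h3 := sinhFactorLog_pos hη hK (k + 1)
    nlinarith
  rw [← Finset.mul_sum] at hle
  have hHn : 0 ≤ ∑ k ∈ Finset.range N, sinhFactorLog η (k + 1) K :=
    Finset.sum_nonneg fun k _ => (sinhFactorLog_pos hη hK (k + 1)).le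
  simp only [Nat.cast_zero, zero_add, one_mul]
  generalize (∑ k ∈ Finset.range N, sinhFactorLog η (k + 1) K) = H at *
  nlinarith [mul_nonneg hHn (sub_nonneg.mpr hH2), mul_nonneg hg0.le (sub_nonneg.mpr hH)]

/-- The partial products of the product formula for `𝒰`. -/
noncomputable def sinhProd (η : ℝ) (N : ℕ) (K : ℝ) : ℝ := ∏ k ∈ Finset.range N, sinhFactor η k K

theorem sinhProd_pos {η : ℝ} (hη : 0 < η) {K : ℝ} (hK : η / 2 < K) (N : ℕ) :
    0 < sinhProd η N K := Finset.prod_pos fun k _ => (sinhFactor_mem hη hK k).1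

theorem hasDerivAt_sinhProd {η : ℝ} (hη : 0 < η) {K : ℝ} (hK : η / 2 < K) (N : ℕ) :
    HasDerivAt (sinhProd η N)
      (sinhProd η N K * ∑ k ∈ Finset.range N, sinhFactorLog η k K) K := by
  induction N with
  | zero =>
    have : sinhProd η 0 = fun _ => 1 := by funext; simp [sinhProd]
    rw [this]
    simpa using hasDerivAt_const K (1 : ℝ)
  | succ N ih =>
    have : sinhProd η (N + 1) = fun K => sinhProd η N K * sinhFactor η N K := by
      funext; simp only [sinhProd, Finset.prod_range_succ]
    rw [this]
    refine (ih.mul (hasDerivAt_sinhFactor hη hK N)).congr_deriv ?_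
    rw [Finset.sum_range_succ]
    ring

theorem hasDerivAt_deriv_sinhProd {η : ℝ} (hη : 0 < η) {K : ℝ} (hK : η / 2 < K) (N : ℕ) :
    HasDerivAt (fun K => sinhProd η N K * ∑ k ∈ Finset.range N, sinhFactorLog η k K)
      (sinhProd η N K * ((∑ k ∈ Finset.range N, sinhFactorLog η k K) ^ 2 +
      ∑ k ∈ Finset.range N, (-(((k : ℝ) + 1) * curvatureRatio (((k : ℝ) + 1) * K) *
        sinhFactorLog η k K) - sinhFactorLog η k K ^ 2))) K := by
  refine ((hasDerivAt_sinhProd hη hK N).mul (HasDerivAt.fun_sum fun k _ =>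
    hasDerivAt_sinhFactorLog hη hK k)).congr_deriv ?_
  ring

theorem monotoneOn_sinhProd {η : ℝ} (hη : 0 < η) (N : ℕ) :
    MonotoneOn (sinhProd η N) (Ioi (η / 2)) := by
  refine monotoneOn_of_deriv_nonneg (convex_Ioi _)
    (fun K hK => (hasDerivAt_sinhProd hη hK N).continuousAt.continuousWithinAt)
    (fun K hK => ?_) fun K hK => ?_
  all_goals rw [interior_Ioi] at hK
  · exact (hasDerivAt_sinhProd hη hK N).differentiableAt.differentiableWithinAt
  · rw [(hasDerivAt_sinhProd hη hK N).deriv]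
    exact mul_nonneg (sinhProd_pos hη hK N).le
      (Finset.sum_nonneg fun k _ => (sinhFactorLog_pos hη hK k).le)

theorem sinh_sq_div_sinh_sq_le {K : ℝ} (hK : 0 < K) (η : ℝ) (k : ℕ) :
    Real.sinh (η / 2) ^ 2 / Real.sinh (((k : ℝ) + 1) * K) ^ 2 ≤
      4 * Real.sinh (η / 2) ^ 2 / (1 - Real.exp (-(2 * K))) ^ 2 *
        Real.exp (-(2 * K)) ^ (k + 1) := by
  obtain ⟨hq0, hq1⟩ := exp_neg_two_mul_mem_Ioo hK
  have hy : 0 < ((k : ℝ) + 1) * K := by positivity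
  have hs := Real.sinh_pos_iff.mpr hy
  have h1 : Real.exp (-(2 * K)) ^ (k + 1) ≤ Real.exp (-(2 * K)) :=
    pow_le_of_le_one hq0.le hq1.le (Nat.succ_ne_zero k)
  have h2 : Real.exp (-(2 * K)) ^ (k + 1) * (4 * Real.sinh (((k : ℝ) + 1) * K) ^ 2) =
      (1 - Real.exp (-(2 * K)) ^ (k + 1)) ^ 2 := by
    rw [← Real.exp_nat_mul, show ((k + 1 : ℕ) : ℝ) * -(2 * K) =
      -(((k : ℝ) + 1) * K) + -(((k : ℝ) + 1) * K) by push_cast; ring, Real.exp_add, Real.sinh_eq]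
    have h4 : Real.exp (-(((k : ℝ) + 1) * K)) * Real.exp (((k : ℝ) + 1) * K) = 1 := by
      rw [← Real.exp_add, neg_add_cancel, Real.exp_zero]
    generalize Real.exp (-(((k : ℝ) + 1) * K)) = a at *
    generalize Real.exp (((k : ℝ) + 1) * K) = b at *
    linear_combination (a * b + 1 - 2 * a ^ 2) * h4
  have h3 : (1 - Real.exp (-(2 * K))) ^ 2 ≤
      Real.exp (-(2 * K)) ^ (k + 1) * (4 * Real.sinh (((k : ℝ) + 1) * K) ^ 2) := by
    rw [h2]
    have : 0 < 1 - Real.exp (-(2 * K)) := by linarith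
    gcongr
  have h5 : 0 < 1 - Real.exp (-(2 * K)) := by linarith
  rw [div_mul_eq_mul_div, div_le_div_iff₀ (by positivity) (by positivity)]
  nlinarith [mul_le_mul_of_nonneg_left h3 (sq_nonneg (Real.sinh (η / 2)))]

theorem summable_sinh_sq_div_sinh_sq {K : ℝ} (hK : 0 < K) (η : ℝ) :
    Summable fun k : ℕ => Real.sinh (η / 2) ^ 2 / Real.sinh (((k : ℝ) + 1) * K) ^ 2 := by
  obtain ⟨hq0, hq1⟩ := exp_neg_two_mul_mem_Ioo hK
  exact Summable.of_nonneg_of_le (fun k => by positivity) (sinh_sq_div_sinh_sq_le hK η)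
    (((summable_nat_add_iff 1).mpr (summable_geometric_of_lt_one hq0.le hq1)).mul_left _)

theorem exists_pos_le_sinhProd {η : ℝ} (hη : 0 < η) {K : ℝ} (hK : η / 2 < K) :
    ∃ δ > 0, ∀ N, δ ≤ sinhProd η N K :=
  exists_pos_le_prod_one_sub (fun k => by positivity)
    (fun k => by have := (sinhFactor_mem hη hK k).1; unfold sinhFactor at this; linarith)
    (summable_sinh_sq_div_sinh_sq (by linarith) η)

/-! ### The function `𝒰` -/

/-- The first derivative of `𝒰`. -/
noncomputable def calU₁ (η K : ℝ) : ℝ :=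
  Real.exp (-(η / 2)) * (thetaSeries 0 η K * thetaSeries 3 0 K -
    thetaSeries 2 η K * thetaSeries 1 0 K) / thetaSeries 1 0 K ^ 2

/-- The second derivative of `𝒰`. -/
noncomputable def calU₂ (η K : ℝ) : ℝ :=
  Real.exp (-(η / 2)) * ((thetaSeries 4 η K * thetaSeries 1 0 K -
    thetaSeries 0 η K * thetaSeries 5 0 K) * thetaSeries 1 0 K + 2 * thetaSeries 3 0 K *
    (thetaSeries 0 η K * thetaSeries 3 0 K - thetaSeries 2 η K * thetaSeries 1 0 K)) /
    thetaSeries 1 0 K ^ 3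

theorem hasDerivAt_calU (η : ℝ) {K : ℝ} (hK : 0 < K) : HasDerivAt (calU η) (calU₁ η K) K := by
  have hd := (thetaSeries_one_zero_pos hK).ne'
  have h := ((hasDerivAt_thetaSeries_right 0 η hK).div
    (hasDerivAt_thetaSeries_right 1 0 hK) hd).const_mul (Real.exp (-(η / 2)))
  refine (h.congr_of_eventuallyEq ?_).congr_deriv ?_
  · filter_upwards [lt_mem_nhds hK] with k hk
    exact calU_eq_thetaSeries η hk
  · unfold calU₁
    field_simp
    ring

theorem hasDerivAt_calU₁ (η : ℝ) {K : ℝ} (hK : 0 < K) : HasDerivAt (calU₁ η) (calU₂ η K) K := by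
  have hd := (thetaSeries_one_zero_pos hK).ne'
  have D (j : ℕ) (u : ℝ) := hasDerivAt_thetaSeries_right j u hK
  have h := ((((D 0 η).mul (D 3 0)).sub ((D 2 η).mul (D 1 0))).const_mul
    (Real.exp (-(η / 2)))).div ((D 1 0).pow 2) (pow_ne_zero 2 hd)
  refine h.congr_deriv ?_
  unfold calU₂
  simp only [Pi.pow_apply, Pi.mul_apply, Pi.sub_apply, Nat.reduceAdd, zero_add,
    Nat.add_one_sub_one, pow_one, Nat.cast_ofNat]
  field_simp
  ring

theorem thetaSeries_two_mul {K : ℝ} (hK : 0 < K) (j : ℕ) : thetaSeries j (2 * K) K =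
    -Real.exp K * ∑ i ∈ Finset.range (j + 1), (j.choose i : ℝ) * thetaSeries i 0 K := by
  simpa using thetaSeries_add_two_mul 0 hK j

theorem calU_half {η : ℝ} (hη : 0 < η) : calU η (η / 2) = 0 ∧ calU₁ η (η / 2) = 2 ∧
    calU₂ η (η / 2) = -4 := by
  have hK : 0 < η / 2 := half_pos hη
  have h := thetaSeries_two_mul hK
  have z0 := thetaSeries_zero_of_even (j := 0) (by decide) (η / 2)
  have z2 := thetaSeries_zero_of_even (j := 2) (by decide) (η / 2)
  have z4 := thetaSeries_zero_of_even (j := 4) (by decide) (η / 2)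
  have h0 := h 0
  have h2 := h 2
  have h4 := h 4
  simp only [Finset.sum_range_succ, Finset.sum_range_zero, z0, z2, z4] at h0 h2 h4
  norm_num [Nat.choose] at h0 h2 h4
  rw [show 2 * (η / 2) = η by ring] at h0 h2 h4
  have hd := (thetaSeries_one_zero_pos hK).ne'
  have he : Real.exp (-(η / 2)) * Real.exp (η / 2) = 1 := by
    rw [← Real.exp_add, neg_add_cancel, Real.exp_zero]
  refine ⟨?_, ?_, ?_⟩
  · rw [calU_eq_thetaSeries η hK, h0, zero_div, mul_zero]
  · rw [calU₁, h0, h2]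
    field_simp
    linear_combination (2 * thetaSeries 1 0 (η / 2) ^ 2) * he
  · rw [calU₂, h0, h2, h4]
    field_simp
    linear_combination (-4 * thetaSeries 1 0 (η / 2) ^ 3) * he

theorem exp_neg_half_mul_sinh (η : ℝ) :
    Real.exp (-(η / 2)) * (2 * Real.sinh (η / 2)) = 1 - Real.exp (-η) := by
  rw [Real.sinh_eq, mul_div_cancel₀ _ two_ne_zero, mul_sub, ← Real.exp_add, ← Real.exp_add,
    neg_add_cancel, Real.exp_zero, ← neg_add, add_halves]

theorem tendsto_sinhProd (η : ℝ) {K : ℝ} (hK : 0 < K) :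
    Tendsto (fun N => (1 - Real.exp (-η)) * sinhProd η N K) atTop (𝓝 (calU η K)) := by
  rw [calU_eq_thetaSeries η hK]
  refine ((tendsto_prod_thetaSeries η hK).const_mul (Real.exp (-(η / 2)))).congr fun N => ?_
  rw [← mul_assoc, exp_neg_half_mul_sinh]
  rfl

theorem one_sub_exp_neg_pos {η : ℝ} (hη : 0 < η) : 0 < 1 - Real.exp (-η) :=
  sub_pos.mpr (Real.exp_lt_one_iff.mpr (by linarith))

/-- A bound for the exponentially fast convergence of `𝒰` at infinity. -/
theorem calU_le_and_le_calU {η : ℝ} (hη : 0 < η) : ∃ C : ℝ, 0 ≤ C ∧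
    ∀ K > max 1 (η / 2), calU η K ≤ 1 - Real.exp (-η) ∧
      1 - Real.exp (-η) - calU η K ≤ C * Real.exp (-K) := by
  have hU := one_sub_exp_neg_pos hη
  obtain ⟨p, hp⟩ : ∃ p, p = Real.exp (-(2 * (1 : ℝ))) := ⟨_, rfl⟩
  have hp1 : p < 1 := hp ▸ (exp_neg_two_mul_mem_Ioo one_pos).2
  refine ⟨(1 - Real.exp (-η)) * (4 * Real.sinh (η / 2) ^ 2 / (1 - p) ^ 2 * (1 / (1 - p))),
    by have := sub_pos.mpr hp1; positivity, fun K hK => ?_⟩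
  have hK1 : 1 < K := (le_max_left _ _).trans_lt hK
  have hKη : η / 2 < K := (le_max_right _ _).trans_lt hK
  have hK0 : 0 < K := by linarith
  obtain ⟨hq0, hq1⟩ := exp_neg_two_mul_mem_Ioo hK0
  have hqp : Real.exp (-(2 * K)) ≤ p := by rw [hp, Real.exp_le_exp]; linarith
  have hqK : Real.exp (-(2 * K)) ≤ Real.exp (-K) := by rw [Real.exp_le_exp]; linarith
  constructor
  · refine le_of_tendsto' (tendsto_sinhProd η hK0) fun N => ?_
    have : sinhProd η N K ≤ 1 := Finset.prod_le_one (fun k _ => (sinhFactor_mem hη hKη k).1.le)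
      fun k _ => (sinhFactor_mem hη hKη k).2.le
    nlinarith
  · have hx (k : ℕ) := sinh_sq_div_sinh_sq_le hK0 η k
    have hsum (N : ℕ) : ∑ k ∈ Finset.range N,
        Real.sinh (η / 2) ^ 2 / Real.sinh (((k : ℝ) + 1) * K) ^ 2 ≤
        4 * Real.sinh (η / 2) ^ 2 / (1 - p) ^ 2 * (1 / (1 - p)) * Real.exp (-K) := by
      refine (Finset.sum_le_sum fun k _ => hx k).trans ?_
      rw [← Finset.mul_sum]
      simp_rw [pow_succ]
      rw [← Finset.sum_mul, mul_assoc _ (1 / (1 - p))]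
      have hg : ∑ k ∈ Finset.range N, Real.exp (-(2 * K)) ^ k ≤ 1 / (1 - p) := by
        have h1 := (summable_geometric_of_lt_one hq0.le hq1).sum_le_tsum (Finset.range N)
          fun k _ => pow_nonneg hq0.le k
        rw [tsum_geometric_of_lt_one hq0.le hq1] at h1
        refine h1.trans ?_
        rw [one_div]
        exact inv_anti₀ (by linarith) (by linarith)
      have h1p : 0 < 1 - p := by linarith
      gcongr
    have hprod (N : ℕ) := one_sub_le_prod_one_sub
      (x := fun k : ℕ => Real.sinh (η / 2) ^ 2 / Real.sinh (((k : ℝ) + 1) * K) ^ 2)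
      (fun k => by positivity)
      (fun k => by have := (sinhFactor_mem hη hKη k).1; unfold sinhFactor at this; linarith) N
    have h2 : (1 - Real.exp (-η)) *
        (1 - 4 * Real.sinh (η / 2) ^ 2 / (1 - p) ^ 2 * (1 / (1 - p)) * Real.exp (-K)) ≤
        calU η K := by
      refine ge_of_tendsto' (tendsto_sinhProd η hK0) fun N => ?_
      refine mul_le_mul_of_nonneg_left ?_ hU.le
      exact (by linarith [hsum N] : _ ≤ _).trans (hprod N)
    linarith

theorem calU₂_neg {η : ℝ} (hη : 0 < η) {K : ℝ} (hK : η / 2 < K) : calU₂ η K < 0 := by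
  have hU := one_sub_exp_neg_pos hη
  obtain ⟨K₁, hK₁, hK₁K⟩ := exists_between hK
  obtain ⟨K₂, hKK₂⟩ := exists_gt K
  obtain ⟨δ, hδ, hδN⟩ := exists_pos_le_sinhProd hη hK₁
  have hX := (sinh_half_lt_sinh hη hK₁ 0).1
  have hs₂ := Real.sinh_pos_iff.mpr (show 0 < K₂ by linarith)
  -- the second derivatives of the partial products are bounded away from `0` near `K`
  obtain ⟨m, hm⟩ : ∃ m, m = 4 * Real.sinh (η / 2) ^ 2 / Real.sinh K₂ ^ 3 * δ := ⟨_, rfl⟩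
  have hm0 : 0 < m := by rw [hm]; positivity
  have hconc (N : ℕ) : ConcaveOn ℝ (Ioo K₁ K₂) fun k => sinhProd η (N + 1) k + m / 2 * k ^ 2 := by
    have hq (k : ℝ) : HasDerivAt (fun k : ℝ => m / 2 * k ^ 2) (m * k) k := by
      refine (((hasDerivAt_id k).pow 2).const_mul (m / 2)).congr_deriv ?_
      simp
      ring
    have hq' (k : ℝ) : HasDerivAt (fun k : ℝ => m * k) m k := by
      simpa using (hasDerivAt_id k).const_mul m
    have hkη {k : ℝ} (hk : k ∈ Ioo K₁ K₂) : η / 2 < k := hK₁.trans hk.1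
    refine concaveOn_of_hasDerivWithinAt2_nonpos (convex_Ioo _ _)
      (fun k hk => ((hasDerivAt_sinhProd hη (hkη hk) (N + 1)).add
        (hq k)).continuousAt.continuousWithinAt)
      (f' := fun k => sinhProd η (N + 1) k *
        ∑ i ∈ Finset.range (N + 1), sinhFactorLog η i k + m * k)
      (f'' := fun k => sinhProd η (N + 1) k *
        ((∑ i ∈ Finset.range (N + 1), sinhFactorLog η i k) ^ 2 +
        ∑ i ∈ Finset.range (N + 1), (-(((i : ℝ) + 1) * curvatureRatio (((i : ℝ) + 1) * k) *
          sinhFactorLog η i k) - sinhFactorLog η i k ^ 2)) + m)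
      (fun k hk => ?_) (fun k hk => ?_) (fun k hk => ?_)
    all_goals rw [interior_Ioo] at hk
    · exact ((hasDerivAt_sinhProd hη (hkη hk) (N + 1)).add (hq k)).hasDerivWithinAt
    · exact ((hasDerivAt_deriv_sinhProd hη (hkη hk) (N + 1)).add (hq' k)).hasDerivWithinAt
    · have h1 := sum_sinhFactorLog_sq_add_le hη (hkη hk) N
      have h2 : δ ≤ sinhProd η (N + 1) k :=
        (hδN (N + 1)).trans (monotoneOn_sinhProd hη (N + 1) hK₁ (hkη hk) hk.1.le)
      have h3 : 2 * Real.sinh (η / 2) ^ 2 / Real.sinh K₂ ^ 3 ≤ sinhFactorLog η 0 k := by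
        obtain ⟨-, h4⟩ := sinh_half_lt_sinh hη (hkη hk) 0
        unfold sinhFactorLog
        simp only [Nat.cast_zero, zero_add, one_mul, mul_one] at h4 ⊢
        have h5 : Real.sinh k ≤ Real.sinh K₂ := Real.sinh_le_sinh.mpr hk.2.le
        have h6 := Real.one_le_cosh k
        have h7 : 0 < Real.sinh k ^ 2 - Real.sinh (η / 2) ^ 2 := by rw [sub_pos]; gcongr
        have h8 : 0 < Real.sinh k := hX.trans h4
        apply div_le_div₀ (by positivity) (by nlinarith [sq_nonneg (Real.sinh (η / 2))])
          (by positivity)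
        rw [pow_succ' (Real.sinh K₂) 2]
        have h9 : Real.sinh k ^ 2 - Real.sinh (η / 2) ^ 2 ≤ Real.sinh K₂ ^ 2 := by
          have : Real.sinh k ^ 2 ≤ Real.sinh K₂ ^ 2 := by gcongr
          nlinarith [sq_nonneg (Real.sinh (η / 2))]
        gcongr
      have h4 := sinhFactorLog_pos hη (hkη hk) 0
      have h5 : sinhProd η (N + 1) k * (2 * sinhFactorLog η 0 k) ≥ m := by
        have h6 := mul_le_mul h3 h2 hδ.le h4.le
        rw [hm]
        have h7 : 4 * Real.sinh (η / 2) ^ 2 / Real.sinh K₂ ^ 3 * δ =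
          2 * (2 * Real.sinh (η / 2) ^ 2 / Real.sinh K₂ ^ 3 * δ) := by ring
        linarith
      have h6 := mul_le_mul_of_nonneg_left h1 (hδ.le.trans h2)
      linarith
  -- hence `𝒰` is strongly concave near `K`
  have hconcU : ConcaveOn ℝ (Ioo K₁ K₂)
      fun k => calU η k + (1 - Real.exp (-η)) * (m / 2 * k ^ 2) := by
    have hlim {k : ℝ} (hk : k ∈ Ioo K₁ K₂) : Tendsto (fun N => (1 - Real.exp (-η)) *
        (sinhProd η (N + 1) k + m / 2 * k ^ 2)) atTop
        (𝓝 (calU η k + (1 - Real.exp (-η)) * (m / 2 * k ^ 2))) := by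
      have h1 := ((tendsto_sinhProd η (show 0 < k by linarith [hk.1])).comp
        (tendsto_add_atTop_nat 1)).add_const ((1 - Real.exp (-η)) * (m / 2 * k ^ 2))
      refine h1.congr fun N => ?_
      simp only [Function.comp_apply]
      ring
    refine ⟨convex_Ioo _ _, fun x hx y hy a b ha hb hab => ?_⟩
    have hxy := (convex_Ioo K₁ K₂) hx hy ha hb hab
    refine le_of_tendsto_of_tendsto' (((hlim hx).const_smul a).add ((hlim hy).const_smul b))
      (hlim hxy) fun N => ?_
    have h1 := mul_le_mul_of_nonneg_left ((hconc N).2 hx hy ha hb hab) hU.le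
    simp only [smul_eq_mul] at h1 ⊢
    linarith
  have hd1 {k : ℝ} (hk : k ∈ Ioo K₁ K₂) : HasDerivAt
      (fun k => calU η k + (1 - Real.exp (-η)) * (m / 2 * k ^ 2))
      (calU₁ η k + (1 - Real.exp (-η)) * (m * k)) k := by
    refine (hasDerivAt_calU η (show 0 < k by linarith [hk.1])).add (HasDerivAt.const_mul _ ?_)
    refine (((hasDerivAt_id k).pow 2).const_mul (m / 2)).congr_deriv ?_
    simp
    ring
  have hanti : AntitoneOn (fun k => calU₁ η k + (1 - Real.exp (-η)) * (m * k)) (Ioo K₁ K₂) := by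
    refine (hconcU.antitoneOn_deriv fun k hk => (hd1 hk).differentiableAt).congr fun k hk => ?_
    exact (hd1 hk).deriv
  have hKmem : K ∈ Ioo K₁ K₂ := ⟨hK₁K, hKK₂⟩
  have hd2 : HasDerivAt (fun k => calU₁ η k + (1 - Real.exp (-η)) * (m * k))
      (calU₂ η K + (1 - Real.exp (-η)) * m) K := by
    refine (hasDerivAt_calU₁ η (show 0 < K by linarith)).add (HasDerivAt.const_mul _ ?_)
    simpa using (hasDerivAt_id K).const_mul m
  have h0 := hanti.derivWithin_nonpos (x := K)
  rw [derivWithin_of_isOpen isOpen_Ioo hKmem, hd2.deriv] at h0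
  nlinarith [mul_pos hU hm0]

theorem calU₁_strictAntiOn {η : ℝ} (hη : 0 < η) : StrictAntiOn (calU₁ η) (Ici (η / 2)) := by
  have hpos {K : ℝ} (hK : η / 2 ≤ K) : 0 < K := (half_pos hη).trans_le hK
  refine strictAntiOn_of_deriv_neg (convex_Ici _)
    (fun K hK => (hasDerivAt_calU₁ η (hpos hK)).continuousAt.continuousWithinAt) fun K hK => ?_
  rw [interior_Ici] at hK
  rw [(hasDerivAt_calU₁ η (hpos hK.le)).deriv]
  exact calU₂_neg hη hK

theorem calU₁_nonneg {η : ℝ} (hη : 0 < η) {K : ℝ} (hK : η / 2 < K) : 0 ≤ calU₁ η K := by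
  have hpos {K : ℝ} (hK : η / 2 < K) : 0 < K := (half_pos hη).trans hK
  have hmono : MonotoneOn (calU η) (Ioi (η / 2)) := fun x hx y hy hxy =>
    le_of_tendsto_of_tendsto' (tendsto_sinhProd η (hpos hx)) (tendsto_sinhProd η (hpos hy))
      fun N => mul_le_mul_of_nonneg_left (monotoneOn_sinhProd hη N hx hy hxy)
        (one_sub_exp_neg_pos hη).le
  have h := hmono.derivWithin_nonneg (x := K)
  rwa [derivWithin_of_isOpen isOpen_Ioi hK, (hasDerivAt_calU η (hpos hK)).deriv] at h

/-- Concavity turns the exponential convergence of `𝒰` into exponential decay of `𝒰'`. -/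
theorem calU₁_le {η : ℝ} (hη : 0 < η) : ∃ C : ℝ, 0 ≤ C ∧
    ∀ K > max 1 (η / 2) + 1, calU₁ η K ≤ C * Real.exp (-K) ∧
      0 ≤ 1 - Real.exp (-η) - calU η K ∧ 1 - Real.exp (-η) - calU η K ≤ C * Real.exp (-K) := by
  obtain ⟨C, hC, h⟩ := calU_le_and_le_calU hη
  have he : 1 ≤ Real.exp 1 := Real.one_le_exp zero_le_one
  refine ⟨C * Real.exp 1, by positivity, fun K hK => ?_⟩
  have hm := le_max_right 1 (η / 2)
  have hK1 : K - 1 > max 1 (η / 2) := by linarith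
  have hK0 : K > max 1 (η / 2) := by linarith
  have hpos {k : ℝ} (hk : K - 1 ≤ k) : 0 < k := by linarith
  refine ⟨?_, by linarith [(h K hK0).1], ?_⟩
  · obtain ⟨ξ, hξ, hξ'⟩ := exists_hasDerivAt_eq_slope (calU η) (calU₁ η)
      (show K - 1 < K by linarith)
      (fun k hk => (hasDerivAt_calU η (hpos hk.1)).continuousAt.continuousWithinAt)
      (fun k hk => hasDerivAt_calU η (hpos hk.1.le))
    have h1 := (calU₁_strictAntiOn hη).antitoneOn (show ξ ∈ Ici (η / 2) from
      (show η / 2 ≤ ξ by linarith [hξ.1])) (show η / 2 ≤ K by linarith) hξ.2.le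
    have h2 := (h K hK0).1
    have h3 := (h (K - 1) hK1).2
    rw [sub_sub_cancel, div_one] at hξ'
    rw [show -(K - 1) = 1 + -K by ring, Real.exp_add] at h3
    linarith
  · have h2 := (h K hK0).2
    have : C * Real.exp (-K) ≤ C * Real.exp 1 * Real.exp (-K) := by
      gcongr
      exact le_mul_of_one_le_right hC he
    linarith

/-! ### The Legendre parametrisation -/

/-- The point `x` with implicit half-period `K`. -/
noncomputable def calX (η K : ℝ) : ℝ := 2 / η * (K * calU₁ η K - calU η K)

theorem isHalfPeriod_iff {η : ℝ} (hη : 0 < η) {x K : ℝ} :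
    IsHalfPeriod η x K ↔ η / 2 < K ∧ calX η K = x := by
  unfold IsHalfPeriod calX
  refine and_congr_right fun hK => ?_
  rw [(hasDerivAt_calU η ((half_pos hη).trans hK)).deriv, div_mul_eq_mul_div, div_eq_iff hη.ne']
  constructor <;> intro h <;> linarith

theorem hasDerivAt_calX (η : ℝ) {K : ℝ} (hK : 0 < K) :
    HasDerivAt (calX η) (2 / η * (K * calU₂ η K)) K := by
  refine ((((hasDerivAt_id K).mul (hasDerivAt_calU₁ η hK)).sub
    (hasDerivAt_calU η hK)).const_mul (2 / η)).congr_deriv ?_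
  simp

theorem calX_half {η : ℝ} (hη : 0 < η) : calX η (η / 2) = 2 := by
  obtain ⟨h0, h1, -⟩ := calU_half hη
  rw [calX, h0, h1]
  field_simp
  ring

theorem calX_strictAntiOn {η : ℝ} (hη : 0 < η) : StrictAntiOn (calX η) (Ici (η / 2)) := by
  have hpos {K : ℝ} (hK : η / 2 ≤ K) : 0 < K := (half_pos hη).trans_le hK
  refine strictAntiOn_of_deriv_neg (convex_Ici _)
    (fun K hK => (hasDerivAt_calX η (hpos hK)).continuousAt.continuousWithinAt) fun K hK => ?_
  rw [interior_Ici] at hK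
  rw [(hasDerivAt_calX η (hpos hK.le)).deriv]
  exact mul_neg_of_pos_of_neg (by positivity) (mul_neg_of_pos_of_neg (hpos hK.le) (calU₂_neg hη hK))

/-- The distance of `calX η K` from the critical point decays exponentially. -/
theorem calX_sub_xStar_le {η : ℝ} (hη : 0 < η) : ∃ C : ℝ, 0 ≤ C ∧
    ∀ᶠ K in atTop, |calX η K - xStar η| ≤ C * (K * Real.exp (-K)) := by
  obtain ⟨C, hC, h⟩ := calU₁_le hη
  refine ⟨2 / η * (2 * C), by positivity, ?_⟩
  filter_upwards [eventually_gt_atTop (max 1 (η / 2) + 1)] with K hK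
  obtain ⟨h1, h2, h3⟩ := h K hK
  have hm := le_max_left 1 (η / 2)
  have hm' := le_max_right 1 (η / 2)
  have h4 := calU₁_nonneg hη (show η / 2 < K by linarith)
  have e : calX η K - xStar η = 2 / η * (K * calU₁ η K + (1 - Real.exp (-η) - calU η K)) := by
    unfold calX xStar
    field_simp
    ring
  have hK1 : 1 ≤ K := by linarith
  have h5 : 0 ≤ K * calU₁ η K := by positivity
  rw [e, abs_of_nonneg (by positivity), mul_assoc (2 / η)]
  refine mul_le_mul_of_nonneg_left ?_ (by positivity)
  have h6 : K * calU₁ η K ≤ K * (C * Real.exp (-K)) := by gcongr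
  have h7 : C * Real.exp (-K) ≤ K * (C * Real.exp (-K)) :=
    le_mul_of_one_le_left (by positivity) hK1
  linarith

theorem tendsto_calX {η : ℝ} (hη : 0 < η) : Tendsto (calX η) atTop (𝓝 (xStar η)) := by
  obtain ⟨C, -, h⟩ := calX_sub_xStar_le hη
  rw [tendsto_iff_norm_sub_tendsto_zero]
  refine squeeze_zero' (Eventually.of_forall fun K => norm_nonneg _) h ?_
  rw [← mul_zero C]
  refine Tendsto.const_mul C ?_
  simpa using Real.tendsto_pow_mul_exp_neg_atTop_nhds_zero 1

theorem calX_mem {η : ℝ} (hη : 0 < η) {K : ℝ} (hK : η / 2 < K) :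
    calX η K ∈ Ioo (xStar η) 2 := by
  have hanti := calX_strictAntiOn hη
  constructor
  · refine lt_of_le_of_lt (le_of_tendsto (tendsto_calX hη) ?_)
      (hanti hK.le (show η / 2 ≤ K + 1 by linarith) (lt_add_one K))
    filter_upwards [eventually_ge_atTop (K + 1)] with k hk
    exact hanti.antitoneOn (show η / 2 ≤ K + 1 by linarith) (show η / 2 ≤ k by linarith) hk
  · rw [← calX_half hη]
    exact hanti self_mem_Ici hK.le hK

theorem existsUnique_isHalfPeriod {η : ℝ} (hη : 0 < η) {x : ℝ} (hx : x ∈ Ioo (xStar η) 2) :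
    ∃! K : ℝ, IsHalfPeriod η x K := by
  simp_rw [isHalfPeriod_iff hη]
  have hanti := calX_strictAntiOn hη
  obtain ⟨M, hM, hMx⟩ := (((tendsto_order.mp (tendsto_calX hη)).2 x hx.1).and
    (eventually_gt_atTop (η / 2))).exists
  have hcont : ContinuousOn (calX η) (Icc (η / 2) M) := fun K hK =>
    (hasDerivAt_calX η ((half_pos hη).trans_le hK.1)).continuousAt.continuousWithinAt
  obtain ⟨K, hK, hKx⟩ := intermediate_value_Ioo' hMx.le hcont
    (show x ∈ Ioo (calX η M) (calX η (η / 2)) by rw [calX_half hη]; exact ⟨hM, hx.2⟩)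
  exact ⟨K, ⟨hK.1, hKx⟩, fun K' hK' => hanti.injOn hK'.1.le hK.1.le (hK'.2.trans hKx.symm)⟩

theorem calK_spec {η : ℝ} (hη : 0 < η) {x : ℝ} (hx : x ∈ Ioo (xStar η) 2) :
    η / 2 < calK η x ∧ calX η (calK η x) = x :=
  (isHalfPeriod_iff hη).mp (Classical.epsilon_spec (existsUnique_isHalfPeriod hη hx).exists)

theorem calK_calX {η : ℝ} (hη : 0 < η) {K : ℝ} (hK : η / 2 < K) : calK η (calX η K) = K := by
  obtain ⟨h1, h2⟩ := calK_spec hη (calX_mem hη hK)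
  exact (calX_strictAntiOn hη).injOn h1.le hK.le h2

theorem lt_calK_iff {η : ℝ} (hη : 0 < η) {x K : ℝ} (hx : x ∈ Ioo (xStar η) 2) (hK : η / 2 ≤ K) :
    K < calK η x ↔ x < calX η K := by
  obtain ⟨h1, h2⟩ := calK_spec hη hx
  conv_rhs => rw [← h2]
  exact ((calX_strictAntiOn hη).lt_iff_gt h1.le hK).symm

theorem calK_lt_iff {η : ℝ} (hη : 0 < η) {x K : ℝ} (hx : x ∈ Ioo (xStar η) 2) (hK : η / 2 ≤ K) :
    calK η x < K ↔ calX η K < x := by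
  obtain ⟨h1, h2⟩ := calK_spec hη hx
  conv_rhs => rw [← h2]
  exact ((calX_strictAntiOn hη).lt_iff_gt hK h1.le).symm

theorem continuousAt_calK {η : ℝ} (hη : 0 < η) {x : ℝ} (hx : x ∈ Ioo (xStar η) 2) :
    ContinuousAt (calK η) x := by
  refine tendsto_order.mpr ⟨fun K hK => ?_, fun K hK => ?_⟩
  · rcases lt_or_ge K (η / 2) with h | h
    · filter_upwards [Ioo_mem_nhds hx.1 hx.2] with y hy using h.trans (calK_spec hη hy).1
    · filter_upwards [Ioo_mem_nhds hx.1 hx.2, gt_mem_nhds ((lt_calK_iff hη hx h).mp hK)] with y hy h'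
      exact (lt_calK_iff hη hy h).mpr h'
  · have h : η / 2 ≤ K := ((calK_spec hη hx).1.trans hK).le
    filter_upwards [Ioo_mem_nhds hx.1 hx.2, lt_mem_nhds ((calK_lt_iff hη hx h).mp hK)] with y hy h'
    exact (calK_lt_iff hη hy h).mpr h'

theorem hasDerivAt_calK {η : ℝ} (hη : 0 < η) {x : ℝ} (hx : x ∈ Ioo (xStar η) 2) :
    HasDerivAt (calK η) (2 / η * (calK η x * calU₂ η (calK η x)))⁻¹ x := by
  obtain ⟨h1, -⟩ := calK_spec hη hx
  have hK := (half_pos hη).trans h1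
  refine HasDerivAt.of_local_left_inverse (continuousAt_calK hη hx) (hasDerivAt_calX η hK)
    (mul_ne_zero (by positivity) (mul_ne_zero hK.ne' (calU₂_neg hη h1).ne)) ?_
  filter_upwards [Ioo_mem_nhds hx.1 hx.2] with y hy using (calK_spec hη hy).2

theorem xStar_lt_two {η : ℝ} (hη : 0 < η) : xStar η < 2 :=
  (calX_mem hη (lt_add_one (η / 2))).1.trans (calX_mem hη (lt_add_one (η / 2))).2

theorem tendsto_calK_two {η : ℝ} (hη : 0 < η) : Tendsto (calK η) (𝓝[<] 2) (𝓝 (η / 2)) := by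
  have hmem := Ioo_mem_nhdsLT (xStar_lt_two hη)
  refine tendsto_order.mpr ⟨fun K hK => ?_, fun K hK => ?_⟩
  · filter_upwards [hmem] with y hy using hK.trans (calK_spec hη hy).1
  · filter_upwards [hmem, Ioo_mem_nhdsLT (calX_mem hη hK).2] with y hy h'
    exact (calK_lt_iff hη hy hK.le).mpr h'.1

theorem tendsto_calK_xStar {η : ℝ} (hη : 0 < η) :
    Tendsto (calK η) (𝓝[>] (xStar η)) atTop := by
  have hmem := Ioo_mem_nhdsGT (xStar_lt_two hη)
  refine tendsto_atTop.mpr fun K => ?_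
  have hK : η / 2 < max K (η / 2) + 1 := by linarith [le_max_right K (η / 2)]
  filter_upwards [hmem, Ioo_mem_nhdsGT (calX_mem hη hK).1] with y hy h'
  have := (lt_calK_iff hη hy hK.le).mpr h'.2
  linarith [le_max_left K (η / 2)]

theorem calL_eq {η : ℝ} (hη : 0 < η) {x : ℝ} (hx : x ∈ Ioo (xStar η) 2) :
    calL η x = -calU₁ η (calK η x) := by
  obtain ⟨h1, h2⟩ := calK_spec hη hx
  have hK := (half_pos hη).trans h1
  have h3 : η * x / 2 = calK η x * calU₁ η (calK η x) - calU η (calK η x) := by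
    conv_lhs => rw [← h2, calX]
    field_simp
  rw [calL, h3]
  field_simp
  ring

/-! ### The antiderivative of `𝒰' ²` -/

/-- An antiderivative of the square of the derivative of `𝒰`. -/
noncomputable def energy (η K : ℝ) : ℝ :=
  Real.exp (-η) / 2 * (thetaSeries 1 0 K * (thetaSeries 0 η K * thetaSeries 2 η K -
    2 * thetaSeries 1 η K ^ 2) + thetaSeries 3 0 K * thetaSeries 0 η K ^ 2) /
    thetaSeries 1 0 K ^ 3

theorem hasDerivAt_energy (η : ℝ) {K : ℝ} (hK : 0 < K) :
    HasDerivAt (energy η) (calU₁ η K ^ 2) K := by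
  have hd := (thetaSeries_one_zero_pos hK).ne'
  have D (j : ℕ) (u : ℝ) := hasDerivAt_thetaSeries_right j u hK
  have h := ((((D 1 0).mul (((D 0 η).mul (D 2 η)).sub (((D 1 η).pow 2).const_mul 2))).add
    ((D 3 0).mul ((D 0 η).pow 2))).const_mul (Real.exp (-η) / 2)).div ((D 1 0).pow 3)
    (pow_ne_zero 3 hd)
  refine h.congr_deriv ?_
  have hh := thetaSeries_hirota η hK hd
  have he : Real.exp (-(η / 2)) ^ 2 = Real.exp (-η) := by
    rw [← Real.exp_nat_mul]; congr 1; push_cast; ring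
  unfold calU₁
  rw [div_pow, mul_pow, he]
  simp only [Pi.pow_apply, Pi.mul_apply, Pi.sub_apply, Pi.add_apply, Nat.reduceAdd, zero_add,
    Nat.add_one_sub_one, pow_one, Nat.cast_ofNat]
  field_simp
  linear_combination (-1 : ℝ) * hh

theorem energy_half {η : ℝ} (hη : 0 < η) : energy η (η / 2) = -1 := by
  have hK : 0 < η / 2 := half_pos hη
  have h := thetaSeries_two_mul hK
  have z0 := thetaSeries_zero_of_even (j := 0) (by decide) (η / 2)
  have h0 := h 0
  have h1 := h 1
  simp only [Finset.sum_range_succ, Finset.sum_range_zero, z0] at h0 h1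
  norm_num at h0 h1
  rw [show 2 * (η / 2) = η by ring] at h0 h1
  have hd := (thetaSeries_one_zero_pos hK).ne'
  have he : Real.exp (-η) * Real.exp (η / 2) ^ 2 = 1 := by
    rw [← Real.exp_nat_mul, ← Real.exp_add, Real.exp_eq_one_iff]; push_cast; ring
  rw [energy, h0, h1]
  field_simp
  linear_combination (-2 * thetaSeries 1 0 (η / 2) ^ 3) * he

theorem tendsto_energy (η : ℝ) : Tendsto (energy η) atTop (𝓝 (-Real.exp (-η))) := by
  have T := tendsto_exp_mul_thetaSeries
  have h := (((((T 1 0).mul (((T 0 η).mul (T 2 η)).sub (((T 1 η).pow 2).const_mul 2))).add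
    ((T 3 0).mul ((T 0 η).pow 2))).const_mul (Real.exp (-η) / 2)).div ((T 1 0).pow 3)
    (by norm_num))
  have he : Real.exp (η / 2) * Real.exp (-η / 2) = 1 := by
    rw [← Real.exp_add, Real.exp_eq_one_iff]; ring
  have hv : Real.exp (-η) / 2 * (((1 / 2) ^ 1 * Real.exp (0 / 2) - (-1 / 2) ^ 1 *
      Real.exp (-0 / 2)) * (((1 / 2) ^ 0 * Real.exp (η / 2) - (-1 / 2) ^ 0 * Real.exp (-η / 2)) *
      ((1 / 2) ^ 2 * Real.exp (η / 2) - (-1 / 2) ^ 2 * Real.exp (-η / 2)) -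
      2 * ((1 / 2) ^ 1 * Real.exp (η / 2) - (-1 / 2) ^ 1 * Real.exp (-η / 2)) ^ 2) +
      ((1 / 2) ^ 3 * Real.exp (0 / 2) - (-1 / 2) ^ 3 * Real.exp (-0 / 2)) *
      ((1 / 2) ^ 0 * Real.exp (η / 2) - (-1 / 2) ^ 0 * Real.exp (-η / 2)) ^ 2) /
      ((1 / 2) ^ 1 * Real.exp (0 / 2) - (-1 / 2) ^ 1 * Real.exp (-0 / 2)) ^ 3 =
      -Real.exp (-η) := by
    norm_num
    linear_combination (-Real.exp (-η)) * he
  rw [hv] at h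
  refine h.congr' ?_
  filter_upwards [eventually_gt_atTop 0] with K hK
  have hd := (thetaSeries_one_zero_pos hK).ne'
  have hE := (Real.exp_pos (K / 4)).ne'
  rw [Pi.div_apply]
  unfold energy
  field_simp

/-! ### Gluing functions of one real variable -/

/-- The function equal to `p` on `(-∞, a]`, to `q` on `(a, b)` and to `r` on `[b, ∞)`. -/
noncomputable def threePiece (a b : ℝ) (p q r : ℝ → ℝ) (x : ℝ) : ℝ :=
  if x ≤ a then p x else if x < b then q x else r x

section threePiece

variable {a b : ℝ} {p q r p' q' r' : ℝ → ℝ}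

theorem threePiece_of_le {x : ℝ} (hx : x ≤ a) : threePiece a b p q r x = p x := if_pos hx

theorem threePiece_of_mem {x : ℝ} (hx : x ∈ Ioo a b) : threePiece a b p q r x = q x := by
  rw [threePiece, if_neg hx.1.not_ge, if_pos hx.2]

theorem threePiece_of_ge (hab : a < b) {x : ℝ} (hx : b ≤ x) : threePiece a b p q r x = r x := by
  rw [threePiece, if_neg (hab.trans_le hx).not_ge, if_neg hx.not_gt]

theorem continuous_threePiece (hab : a < b) (hp : Continuous p) (hq : ContinuousOn q (Ioo a b))
    (hr : Continuous r) (ha : Tendsto q (𝓝[>] a) (𝓝 (p a))) (hb : Tendsto q (𝓝[<] b) (𝓝 (r b))) :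
    Continuous (threePiece a b p q r) := by
  have hmid : ∀ {x}, x ∈ Ioo a b → ContinuousAt (threePiece a b p q r) x := fun {x} hx =>
    (hq.continuousAt (Ioo_mem_nhds hx.1 hx.2)).congr
      (by filter_upwards [Ioo_mem_nhds hx.1 hx.2] with y hy using (threePiece_of_mem hy).symm)
  refine continuous_iff_continuousAt.mpr fun x => ?_
  rcases lt_trichotomy x a with h | rfl | h
  · exact hp.continuousAt.congr
      (by filter_upwards [gt_mem_nhds h] with y hy using (threePiece_of_le hy.le).symm)
  · refine continuousAt_iff_continuous_left'_right'.mpr ⟨?_, ?_⟩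
    · refine (hp.continuousAt.continuousWithinAt).congr (fun y hy => threePiece_of_le (le_of_lt hy))
        (threePiece_of_le le_rfl)
    · rw [ContinuousWithinAt, threePiece_of_le le_rfl]
      refine ha.congr' ?_
      filter_upwards [Ioo_mem_nhdsGT hab] with y hy using (threePiece_of_mem hy).symm
  rcases lt_trichotomy x b with h' | rfl | h'
  · exact hmid ⟨h, h'⟩
  · refine continuousAt_iff_continuous_left'_right'.mpr ⟨?_, ?_⟩
    · rw [ContinuousWithinAt, threePiece_of_ge hab le_rfl]
      refine hb.congr' ?_
      filter_upwards [Ioo_mem_nhdsLT hab] with y hy using (threePiece_of_mem hy).symm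
    · exact (hr.continuousAt.continuousWithinAt).congr
        (fun y hy => threePiece_of_ge hab (le_of_lt hy)) (threePiece_of_ge hab le_rfl)
  · exact hr.continuousAt.congr
      (by filter_upwards [lt_mem_nhds h'] with y hy using (threePiece_of_ge hab hy.le).symm)

/-- A function is differentiable at a point if it is continuous there and its derivative nearby
extends continuously. -/
theorem hasDerivAt_of_eventually_ne {f g : ℝ → ℝ} {x : ℝ}
    (hd : ∀ᶠ y in 𝓝[≠] x, HasDerivAt f (g y) y) (hf : ContinuousAt f x) (hg : ContinuousAt g x) :
    HasDerivAt f (g x) x := by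
  have hR : ∀ᶠ y in 𝓝[>] x, HasDerivAt f (g y) y :=
    hd.filter_mono (nhdsWithin_mono x fun y hy => ne_of_gt hy)
  have hL : ∀ᶠ y in 𝓝[<] x, HasDerivAt f (g y) y :=
    hd.filter_mono (nhdsWithin_mono x fun y hy => ne_of_lt hy)
  have h1 : HasDerivWithinAt f (g x) (Ici x) x :=
    hasDerivWithinAt_Ici_of_tendsto_deriv (s := {y | HasDerivAt f (g y) y})
      (fun y hy => (HasDerivAt.differentiableAt hy).differentiableWithinAt)
      hf.continuousWithinAt hR
      ((hg.tendsto.mono_left nhdsWithin_le_nhds).congr' (hR.mono fun y hy => hy.deriv.symm))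
  have h2 : HasDerivWithinAt f (g x) (Iic x) x :=
    hasDerivWithinAt_Iic_of_tendsto_deriv (s := {y | HasDerivAt f (g y) y})
      (fun y hy => (HasDerivAt.differentiableAt hy).differentiableWithinAt)
      hf.continuousWithinAt hL
      ((hg.tendsto.mono_left nhdsWithin_le_nhds).congr' (hL.mono fun y hy => hy.deriv.symm))
  simpa using h2.union h1

theorem hasDerivAt_threePiece (hab : a < b) (hp : ∀ x, HasDerivAt p (p' x) x)
    (hq : ∀ x ∈ Ioo a b, HasDerivAt q (q' x) x) (hr : ∀ x, HasDerivAt r (r' x) x)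
    (hcont : Continuous (threePiece a b p q r)) (hcont' : Continuous (threePiece a b p' q' r'))
    (x : ℝ) : HasDerivAt (threePiece a b p q r) (threePiece a b p' q' r' x) x := by
  have hne : ∀ y, y ≠ a → y ≠ b →
      HasDerivAt (threePiece a b p q r) (threePiece a b p' q' r' y) y := by
    intro y ha hb
    rcases lt_or_gt_of_ne ha with h | h
    · rw [threePiece_of_le h.le]
      refine (hp y).congr_of_eventuallyEq ?_
      filter_upwards [gt_mem_nhds h] with z hz using threePiece_of_le hz.le
    rcases lt_or_gt_of_ne hb with h' | h'
    · rw [threePiece_of_mem ⟨h, h'⟩]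
      refine (hq y ⟨h, h'⟩).congr_of_eventuallyEq ?_
      filter_upwards [Ioo_mem_nhds h h'] with z hz using threePiece_of_mem hz
    · rw [threePiece_of_ge hab h'.le]
      refine (hr y).congr_of_eventuallyEq ?_
      filter_upwards [lt_mem_nhds h'] with z hz using threePiece_of_ge hab hz.le
  refine hasDerivAt_of_eventually_ne ?_ hcont.continuousAt hcont'.continuousAt
  have hfin : (({a, b} : Set ℝ) \ {x})ᶜ ∈ 𝓝 x :=
    ((Set.toFinite _).isClosed.isOpen_compl).mem_nhds (by simp)
  filter_upwards [nhdsWithin_le_nhds hfin, self_mem_nhdsWithin] with y hy hyx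
  refine hne y (fun h => hy ⟨?_, hyx⟩) (fun h => hy ⟨?_, hyx⟩) <;> simp [h]

end threePiece

/-- Integrating an order estimate of the derivative. -/
theorem isBigO_sub_pow_succ {f f' : ℝ → ℝ} {s : Set ℝ} {b : ℝ} {n : ℕ} (hs : s.OrdConnected)
    (hb : b ∈ s) (hd : ∀ x ∈ s, HasDerivAt f (f' x) x)
    (hO : f' =O[𝓝[s] b] fun x => (x - b) ^ n) :
    (fun x => f x - f b) =O[𝓝[s] b] fun x => (x - b) ^ (n + 1) := by
  obtain ⟨C, hC⟩ := hO.bound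
  obtain ⟨ε, hε, hball⟩ := Metric.mem_nhdsWithin_iff.mp hC
  refine IsBigO.of_bound C ?_
  filter_upwards [inter_mem_nhdsWithin s (Metric.ball_mem_nhds b hε)] with x hx
  have hsub : uIcc b x ⊆ s := hs.uIcc_subset hb hx.1
  have hdist {y : ℝ} (hy : y ∈ uIcc b x) : |y - b| ≤ |x - b| := abs_sub_left_of_mem_uIcc hy
  have h := (convex_uIcc b x).norm_image_sub_le_of_norm_hasDerivWithin_le (f := f) (f' := f')
    (C := C * |x - b| ^ n) (fun y hy => (hd y (hsub hy)).hasDerivWithinAt) (fun y hy => ?_)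
    left_mem_uIcc right_mem_uIcc
  · rw [norm_pow, pow_succ, ← mul_assoc]
    exact h
  · have hyb : y ∈ Metric.ball b ε := by
      have := hx.2
      rw [Metric.mem_ball, Real.dist_eq] at this ⊢
      exact (hdist hy).trans_lt this
    have h1 : ‖f' y‖ ≤ C * ‖(y - b) ^ n‖ := hball ⟨hyb, hsub hy⟩
    rw [norm_pow, Real.norm_eq_abs (y - b)] at h1
    rcases le_or_gt 0 C with hC0 | hC0
    · refine h1.trans ?_
      have := hdist hy
      gcongr
    · have h2 : 0 ≤ C * |y - b| ^ n := (norm_nonneg _).trans h1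
      have h3 : C * ‖(x - b) ^ n‖ ≥ 0 := (norm_nonneg _).trans (hball ⟨hx.2, hx.1⟩)
      rw [norm_pow, Real.norm_eq_abs (x - b)] at h3
      have h4 : |y - b| ^ n = 0 := by
        have := pow_nonneg (abs_nonneg (y - b)) n
        nlinarith
      rw [h4, mul_zero] at h1
      exact h1.trans h3

/-! ### The rate function and its derivatives -/

theorem tendsto_mul_sq_sub_energy {η : ℝ} (hη : 0 < η) :
    Tendsto (fun K => K * calU₁ η K ^ 2 - energy η K) atTop (𝓝 (Real.exp (-η))) := by
  obtain ⟨C, hC, h⟩ := calU₁_le hη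
  have h1 : Tendsto (fun K => K * calU₁ η K ^ 2) atTop (𝓝 0) := by
    have h2 : Tendsto (fun K : ℝ => C ^ 2 * (K ^ 1 * Real.exp (-K))) atTop (𝓝 (C ^ 2 * 0)) :=
      (Real.tendsto_pow_mul_exp_neg_atTop_nhds_zero 1).const_mul _
    rw [mul_zero] at h2
    refine squeeze_zero' ?_ ?_ h2
    · filter_upwards [eventually_ge_atTop 0] with K hK
      positivity
    · filter_upwards [eventually_gt_atTop (max 1 (η / 2) + 1)] with K hK
      have hm := le_max_left 1 (η / 2)
      have hm' := le_max_right 1 (η / 2)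
      have h3 := (h K hK).1
      have h4 := calU₁_nonneg hη (show η / 2 < K by linarith)
      have h5 : Real.exp (-K) ≤ 1 := Real.exp_le_one_iff.mpr (by linarith)
      have h6 := Real.exp_pos (-K)
      have h7 : calU₁ η K ^ 2 ≤ (C * Real.exp (-K)) ^ 2 := by gcongr
      have h8 : (C * Real.exp (-K)) ^ 2 ≤ C ^ 2 * Real.exp (-K) := by
        rw [mul_pow]
        have : Real.exp (-K) ^ 2 ≤ Real.exp (-K) := by nlinarith
        gcongr
      have hK0 : 0 ≤ K := by linarith
      calc K * calU₁ η K ^ 2 ≤ K * (C ^ 2 * Real.exp (-K)) := by gcongr; linarith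
        _ = C ^ 2 * (K ^ 1 * Real.exp (-K)) := by ring
  have h2 := h1.sub (tendsto_energy η)
  rw [zero_sub, neg_neg] at h2
  exact h2

theorem intervalIntegrable_calL_and_integral {η : ℝ} (hη : 0 < η) {x : ℝ}
    (hx : x ∈ Ioo (xStar η) 2) :
    IntervalIntegrable (calL η) MeasureTheory.volume (xStar η) x ∧
      η * ∫ y in (xStar η)..x, calL η y =
        Real.exp (-η) - (calK η x * calU₁ η (calK η x) ^ 2 - energy η (calK η x)) := by
  obtain ⟨B, hB⟩ : ∃ B : ℝ → ℝ, B = fun K => K * calU₁ η K ^ 2 - energy η K := ⟨_, rfl⟩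
  have hBd {K : ℝ} (hK : 0 < K) : HasDerivAt B (2 * K * calU₁ η K * calU₂ η K) K := by
    rw [hB]
    refine (((hasDerivAt_id K).mul ((hasDerivAt_calU₁ η hK).pow 2)).sub
      (hasDerivAt_energy η hK)).congr_deriv ?_
    simp
    ring
  have hBlim : Tendsto B atTop (𝓝 (Real.exp (-η))) := hB ▸ tendsto_mul_sq_sub_energy hη
  -- an antiderivative of `- η ℒ`, extended continuously to the critical point
  obtain ⟨G, hG⟩ : ∃ G : ℝ → ℝ, G = fun y => if y ≤ xStar η then Real.exp (-η) else B (calK η y) :=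
    ⟨_, rfl⟩
  have hGeq {y : ℝ} (hy : xStar η < y) : G y = B (calK η y) := by
    rw [hG]; exact if_neg hy.not_ge
  have hGd {y : ℝ} (hy : y ∈ Ioo (xStar η) 2) : HasDerivAt G (-η * calL η y) y := by
    obtain ⟨h1, -⟩ := calK_spec hη hy
    have hK := (half_pos hη).trans h1
    refine (((hBd hK).comp y (hasDerivAt_calK hη hy)).congr_of_eventuallyEq ?_).congr_deriv ?_
    · filter_upwards [lt_mem_nhds hy.1] with z hz using hGeq hz
    · rw [calL_eq hη hy]
      have := (calU₂_neg hη h1).ne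
      field_simp
  have hIoo {y : ℝ} (hy : y ∈ Ioo (xStar η) x) : y ∈ Ioo (xStar η) 2 := ⟨hy.1, hy.2.trans hx.2⟩
  have hcont : ContinuousOn G (Icc (xStar η) x) := by
    intro y hy
    rcases hy.1.eq_or_lt with rfl | h
    · have h1 : G (xStar η) = Real.exp (-η) := by rw [hG]; exact if_pos le_rfl
      have h2 : ContinuousWithinAt G (Ioi (xStar η)) (xStar η) := by
        rw [ContinuousWithinAt, h1]
        refine (hBlim.comp (tendsto_calK_xStar hη)).congr' ?_
        filter_upwards [self_mem_nhdsWithin] with z hz using (hGeq hz).symm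
      exact (continuousWithinAt_Ioi_iff_Ici.mp h2).mono fun z hz => hz.1
    · exact (hGd ⟨h, hy.2.trans_lt hx.2⟩).continuousAt.continuousWithinAt
  have hint' : IntervalIntegrable (fun y => -η * calL η y) MeasureTheory.volume (xStar η) x := by
    refine intervalIntegral.intervalIntegrable_deriv_of_nonneg (g := G) ?_ ?_ ?_
    · rwa [uIcc_of_le hx.1.le]
    all_goals rw [min_eq_left hx.1.le, max_eq_right hx.1.le]
    · exact fun y hy => hGd (hIoo hy)
    · intro y hy
      rw [calL_eq hη (hIoo hy), neg_mul_neg]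
      exact mul_nonneg hη.le (calU₁_nonneg hη (calK_spec hη (hIoo hy)).1)
  have hFTC := intervalIntegral.integral_eq_sub_of_hasDerivAt_of_le hx.1.le hcont
    (fun y hy => hGd (hIoo hy)) hint'
  refine ⟨?_, ?_⟩
  · refine (hint'.const_mul (-η)⁻¹).congr fun y _ => ?_
    field_simp
  · rw [intervalIntegral.integral_const_mul, hGeq hx.1] at hFTC
    rw [hG] at hFTC
    simp only [le_refl, if_true] at hFTC
    rw [hB] at hFTC
    linarith

/-- The rate function between the two transition points. -/
noncomputable def rateMid (η x : ℝ) : ℝ :=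
  η * x ^ 2 / 2 + 1 - (calK η x * calU₁ η (calK η x) ^ 2 - energy η (calK η x))

/-- The first derivative of the rate function. -/
noncomputable def rateDeriv (η : ℝ) : ℝ → ℝ :=
  threePiece (xStar η) 2 (fun x => η * x) (fun x => η * (x - calU₁ η (calK η x))) fun _ => 0

/-- The second derivative of the rate function. -/
noncomputable def rateDeriv₂ (η : ℝ) : ℝ → ℝ :=
  threePiece (xStar η) 2 (fun _ => η) (fun x => η * (1 - η / (2 * calK η x))) fun _ => 0

theorem rateFunction_eq {η : ℝ} (hη : 0 < η) :
    rateFunction η = threePiece (xStar η) 2 (fun x => η * x ^ 2 / 2 + 1 - Real.exp (-η))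
      (rateMid η) fun _ => 0 := by
  funext x
  unfold rateFunction threePiece
  split_ifs with h1 h2
  · rfl
  · rw [(intervalIntegrable_calL_and_integral hη ⟨not_le.mp h1, h2⟩).2, rateMid]
    ring
  · rfl

theorem hasDerivAt_rateMid {η : ℝ} (hη : 0 < η) {x : ℝ} (hx : x ∈ Ioo (xStar η) 2) :
    HasDerivAt (rateMid η) (η * (x - calU₁ η (calK η x))) x := by
  obtain ⟨h1, -⟩ := calK_spec hη hx
  have hK := (half_pos hη).trans h1
  have hne := (calU₂_neg hη h1).ne
  have hKd := hasDerivAt_calK hη hx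
  have h := (((((hasDerivAt_id x).pow 2).const_mul η).div_const 2).add_const 1).sub
    ((hKd.mul (((hasDerivAt_calU₁ η hK).comp x hKd).pow 2)).sub
      ((hasDerivAt_energy η hK).comp x hKd))
  refine h.congr_deriv ?_
  simp
  field_simp
  ring

theorem hasDerivAt_calU₁_calK {η : ℝ} (hη : 0 < η) {x : ℝ} (hx : x ∈ Ioo (xStar η) 2) :
    HasDerivAt (fun x => η * (x - calU₁ η (calK η x))) (η * (1 - η / (2 * calK η x))) x := by
  obtain ⟨h1, -⟩ := calK_spec hη hx
  have hK := (half_pos hη).trans h1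
  have hne := (calU₂_neg hη h1).ne
  refine (((hasDerivAt_id x).sub ((hasDerivAt_calU₁ η hK).comp x
    (hasDerivAt_calK hη hx))).const_mul η).congr_deriv ?_
  field_simp

theorem tendsto_calU₁_atTop {η : ℝ} (hη : 0 < η) : Tendsto (calU₁ η) atTop (𝓝 0) := by
  obtain ⟨C, hC, h⟩ := calU₁_le hη
  have h2 : Tendsto (fun K : ℝ => C * Real.exp (-K)) atTop (𝓝 (C * 0)) :=
    (Real.tendsto_exp_neg_atTop_nhds_zero).const_mul _
  rw [mul_zero] at h2
  refine squeeze_zero' ?_ ?_ h2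
  · filter_upwards [eventually_gt_atTop (η / 2)] with K hK using calU₁_nonneg hη hK
  · filter_upwards [eventually_gt_atTop (max 1 (η / 2) + 1)] with K hK using (h K hK).1

theorem continuous_rateFunction {η : ℝ} (hη : 0 < η) : Continuous (rateFunction η) := by
  rw [rateFunction_eq hη]
  refine continuous_threePiece (xStar_lt_two hη) (by fun_prop)
    (fun x hx => (hasDerivAt_rateMid hη hx).continuousAt.continuousWithinAt) continuous_const ?_ ?_
  · have hx : Tendsto (fun x : ℝ => η * x ^ 2 / 2 + 1) (𝓝[>] (xStar η))
        (𝓝 (η * xStar η ^ 2 / 2 + 1)) :=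
      (Continuous.tendsto (by fun_prop) _).mono_left nhdsWithin_le_nhds
    exact hx.sub ((tendsto_mul_sq_sub_energy hη).comp (tendsto_calK_xStar hη))
  · have hK := half_pos hη
    obtain ⟨-, h1, -⟩ := calU_half hη
    have hcont : ContinuousAt (fun K => K * calU₁ η K ^ 2 - energy η K) (η / 2) :=
      (continuousAt_id.mul ((hasDerivAt_calU₁ η hK).continuousAt.pow 2)).sub
        (hasDerivAt_energy η hK).continuousAt
    have hx : Tendsto (fun x : ℝ => η * x ^ 2 / 2 + 1) (𝓝[<] 2) (𝓝 (η * 2 ^ 2 / 2 + 1)) :=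
      (Continuous.tendsto (by fun_prop) 2).mono_left nhdsWithin_le_nhds
    have h2 := hx.sub (hcont.tendsto.comp (tendsto_calK_two hη))
    rw [h1, energy_half hη, show η * 2 ^ 2 / 2 + 1 - (η / 2 * 2 ^ 2 - -1) = 0 by ring] at h2
    exact h2

theorem continuous_rateDeriv {η : ℝ} (hη : 0 < η) : Continuous (rateDeriv η) := by
  refine continuous_threePiece (xStar_lt_two hη) (by fun_prop)
    (fun x hx => (hasDerivAt_calU₁_calK hη hx).continuousAt.continuousWithinAt)
    continuous_const ?_ ?_
  · have hx : Tendsto (fun x : ℝ => x) (𝓝[>] (xStar η)) (𝓝 (xStar η)) := nhdsWithin_le_nhds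
    have h2 := (hx.sub ((tendsto_calU₁_atTop hη).comp (tendsto_calK_xStar hη))).const_mul η
    rw [sub_zero] at h2
    exact h2
  · have hx : Tendsto (fun x : ℝ => x) (𝓝[<] 2) (𝓝 2) := nhdsWithin_le_nhds
    have h2 := (hx.sub ((hasDerivAt_calU₁ η (half_pos hη)).continuousAt.tendsto.comp
      (tendsto_calK_two hη))).const_mul η
    rw [(calU_half hη).2.1, sub_self, mul_zero] at h2
    exact h2

theorem continuous_rateDeriv₂ {η : ℝ} (hη : 0 < η) : Continuous (rateDeriv₂ η) := by
  refine continuous_threePiece (xStar_lt_two hη) continuous_const (fun x hx => ?_)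
    continuous_const ?_ ?_
  · have hK := (half_pos hη).trans (calK_spec hη hx).1
    have := continuousAt_calK hη hx
    refine ContinuousAt.continuousWithinAt (ContinuousAt.mul continuousAt_const
      (continuousAt_const.sub (continuousAt_const.div (continuousAt_const.mul this) ?_)))
    positivity
  · have h := (((tendsto_calK_xStar hη).const_mul_atTop two_pos).const_div_atTop η).const_sub 1
      |>.const_mul η
    rw [sub_zero, mul_one] at h
    exact h
  · have h := ((tendsto_const_nhds (x := η)).div ((tendsto_calK_two hη).const_mul 2)
      (by linarith)).const_sub 1 |>.const_mul η
    rw [mul_div_cancel₀ _ two_ne_zero, div_self hη.ne', sub_self, mul_zero] at h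
    exact h

theorem hasDerivAt_rateFunction {η : ℝ} (hη : 0 < η) (x : ℝ) :
    HasDerivAt (rateFunction η) (rateDeriv η x) x := by
  have h := continuous_rateFunction hη
  rw [rateFunction_eq hη] at h ⊢
  refine hasDerivAt_threePiece (xStar_lt_two hη) (fun x => ?_)
    (fun x hx => hasDerivAt_rateMid hη hx) (fun x => hasDerivAt_const x 0) h
    (continuous_rateDeriv hη) x
  refine ((((((hasDerivAt_id x).pow 2).const_mul η).div_const 2).add_const 1).sub_const
    (Real.exp (-η))).congr_deriv ?_
  simp
  ring

theorem hasDerivAt_rateDeriv {η : ℝ} (hη : 0 < η) (x : ℝ) :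
    HasDerivAt (rateDeriv η) (rateDeriv₂ η x) x := by
  refine hasDerivAt_threePiece (xStar_lt_two hη) (fun x => ?_)
    (fun x hx => hasDerivAt_calU₁_calK hη hx) (fun x => hasDerivAt_const x 0)
    (continuous_rateDeriv hη) (continuous_rateDeriv₂ hη) x
  simpa using (hasDerivAt_id x).const_mul η

theorem iteratedDeriv_two_rateFunction {η : ℝ} (hη : 0 < η) :
    iteratedDeriv 2 (rateFunction η) = rateDeriv₂ η := by
  rw [iteratedDeriv_succ, iteratedDeriv_one,
    show deriv (rateFunction η) = rateDeriv η from
      funext fun x => (hasDerivAt_rateFunction hη x).deriv]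
  exact funext fun x => (hasDerivAt_rateDeriv hη x).deriv

theorem contDiff_two_rateFunction {η : ℝ} (hη : 0 < η) : ContDiff ℝ 2 (rateFunction η) := by
  rw [show (2 : WithTop ℕ∞) = 1 + 1 by norm_num, contDiff_succ_iff_deriv]
  refine ⟨fun x => (hasDerivAt_rateFunction hη x).differentiableAt, by simp, ?_⟩
  rw [show deriv (rateFunction η) = rateDeriv η from
      funext fun x => (hasDerivAt_rateFunction hη x).deriv, contDiff_one_iff_deriv]
  refine ⟨fun x => (hasDerivAt_rateDeriv hη x).differentiableAt, ?_⟩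
  rw [show deriv (rateDeriv η) = rateDeriv₂ η from
      funext fun x => (hasDerivAt_rateDeriv hη x).deriv]
  exact continuous_rateDeriv₂ hη

/-! ### Behaviour at the two transition points -/

theorem not_holder_rateDeriv₂ {η : ℝ} (hη : 0 < η) {α : ℝ} (hα : 0 < α) :
    ¬ ∃ C : ℝ, ∀ᶠ x in 𝓝 (xStar η),
      |rateDeriv₂ η x - rateDeriv₂ η (xStar η)| ≤ C * |x - xStar η| ^ α := by
  rintro ⟨C, hC⟩
  obtain ⟨D, hD, hdist⟩ := calX_sub_xStar_le hη
  have h1 := (tendsto_calX hη).eventually hC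
  have hlim : Tendsto (fun K : ℝ => |C| * (D ^ α * (K ^ (1 + α) * Real.exp (-α * K)))) atTop
      (𝓝 (|C| * (D ^ α * 0))) :=
    ((tendsto_rpow_mul_exp_neg_mul_atTop_nhds_zero (1 + α) α hα).const_mul _).const_mul _
  rw [mul_zero, mul_zero] at hlim
  have h2 := (tendsto_order.mp hlim).2 (η ^ 2 / 2) (by positivity)
  obtain ⟨K, h1, h2, h3, hK⟩ := (h1.and (h2.and (hdist.and
    (eventually_gt_atTop (max 1 (η / 2)))))).exists
  have hKη : η / 2 < K := (le_max_right _ _).trans_lt hK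
  have hK0 : 0 < K := (half_pos hη).trans hKη
  rw [rateDeriv₂, threePiece_of_le le_rfl, threePiece_of_mem (calX_mem hη hKη),
    calK_calX hη hKη, show η * (1 - η / (2 * K)) - η = -(η ^ 2 / 2 / K) by field_simp; ring,
    abs_neg, abs_of_pos (by positivity), div_le_iff₀ hK0] at h1
  have h4 : |calX η K - xStar η| ^ α ≤ D ^ α * (K ^ α * Real.exp (-α * K)) := by
    refine (Real.rpow_le_rpow (abs_nonneg _) h3 hα.le).trans_eq ?_
    rw [Real.mul_rpow hD (by positivity), Real.mul_rpow hK0.le (Real.exp_pos _).le, ← Real.exp_mul]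
    congr 3
    ring_nf
  have h5 : C * |calX η K - xStar η| ^ α * K ≤
      |C| * (D ^ α * (K ^ (1 + α) * Real.exp (-α * K))) := by
    rw [Real.rpow_add hK0, Real.rpow_one]
    calc C * |calX η K - xStar η| ^ α * K ≤ |C| * |calX η K - xStar η| ^ α * K := by
          gcongr; exact le_abs_self C
      _ ≤ |C| * (D ^ α * (K ^ α * Real.exp (-α * K))) * K := by gcongr
      _ = _ := by ring
  linarith

theorem differentiableAt_calU₂ (η : ℝ) {K : ℝ} (hK : 0 < K) : DifferentiableAt ℝ (calU₂ η) K := by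
  have D (j : ℕ) (u : ℝ) := (hasDerivAt_thetaSeries_right j u hK).differentiableAt
  have hd := (thetaSeries_one_zero_pos hK).ne'
  unfold calU₂
  refine DifferentiableAt.div ?_ ((D 1 0).pow 3) (pow_ne_zero 3 hd)
  exact ((((((D 4 η).mul (D 1 0)).sub ((D 0 η).mul (D 5 0))).mul (D 1 0)).add
    (((D 3 0).const_mul 2).mul (((D 0 η).mul (D 3 0)).sub ((D 2 η).mul (D 1 0)))))).const_mul _

/-- Near `2` the second derivative of the rate function is `(2 - x) / 2` to first order. -/
theorem rateDeriv₂_sub_isBigO {η : ℝ} (hη : 0 < η) :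
    (fun x => rateDeriv₂ η x - (2 - x) / 2) =O[𝓝[Iic 2] 2] fun x : ℝ => (x - 2) ^ 2 := by
  have ha := half_pos hη
  obtain ⟨-, -, hU₂⟩ := calU_half hη
  -- the same quantity as a function of the half-period
  obtain ⟨r, hr⟩ : ∃ r : ℝ → ℝ, r = fun K => η * (1 - η / (2 * K)) - (2 - calX η K) / 2 := ⟨_, rfl⟩
  obtain ⟨r', hr'⟩ : ∃ r' : ℝ → ℝ, r' = fun K => η ^ 2 / (2 * K ^ 2) + K * calU₂ η K / η :=
    ⟨_, rfl⟩
  have hrd : ∀ K ∈ Ioi (0 : ℝ), HasDerivAt r (r' K) K := by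
    intro K hK
    have hK' : K ≠ 0 := ne_of_gt hK
    rw [hr, hr']
    refine ((((((hasDerivAt_id K).const_mul 2).fun_inv (by simpa using hK')).const_mul
      η).const_sub 1).const_mul η |>.sub
      (((hasDerivAt_calX η hK).const_sub 2).div_const 2)).congr_deriv ?_
    simp
    field_simp
    ring
  have hr'O : r' =O[𝓝[Ioi 0] (η / 2)] fun K => (K - η / 2) ^ 1 := by
    have hdiff : DifferentiableAt ℝ r' (η / 2) := by
      rw [hr']
      refine DifferentiableAt.add (DifferentiableAt.div (by fun_prop) (by fun_prop)
        (by positivity)) ((differentiableAt_id.mul (differentiableAt_calU₂ η ha)).div_const η)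
    have h0 : r' (η / 2) = 0 := by
      rw [hr']
      simp only [hU₂]
      field_simp
      ring
    have := hdiff.hasDerivAt.isBigO_sub
    simp only [h0, sub_zero] at this
    simp only [pow_one]
    exact this.mono nhdsWithin_le_nhds
  have hrO := isBigO_sub_pow_succ (ordConnected_Ioi) ha hrd hr'O
  have hr0 : r (η / 2) = 0 := by
    rw [hr]
    simp only [calX_half hη]
    field_simp
    ring
  simp only [hr0, sub_zero] at hrO
  rw [nhdsWithin_eq_nhds.mpr (Ioi_mem_nhds ha)] at hrO
  have hX : (fun K => K - η / 2) =O[𝓝 (η / 2)] fun K => calX η K - 2 := by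
    have h := (hasDerivAt_calX η ha)
    have h1 : 2 / η * (η / 2 * calU₂ η (η / 2)) ≠ 0 := by
      rw [hU₂]
      have : 2 / η * (η / 2 * -4) = -4 := by field_simp
      rw [this]; norm_num
    have h2 := ((h.isTheta_sub h1).isBigO_symm).comp_tendsto
      ((tendsto_id (x := 𝓝 (η / 2))).prodMk tendsto_const_pure)
    simpa [Function.comp_def, calX_half hη] using h2
  have h1 := (hrO.trans (hX.pow 2)).comp_tendsto (tendsto_calK_two hη)
  have h2 : (fun x => rateDeriv₂ η x - (2 - x) / 2) =O[𝓝[<] 2] fun x : ℝ => (x - 2) ^ 2 := by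
    refine h1.congr' ?_ ?_
    · filter_upwards [Ioo_mem_nhdsLT (xStar_lt_two hη)] with x hx
      rw [rateDeriv₂, threePiece_of_mem hx, Function.comp_apply, hr]
      simp only [(calK_spec hη hx).2]
    · filter_upwards [Ioo_mem_nhdsLT (xStar_lt_two hη)] with x hx
      simp only [Function.comp_apply, (calK_spec hη hx).2]
  obtain ⟨C, hC⟩ := h2.isBigOWith
  rw [← Iio_insert]
  refine (hC.insert ?_).isBigO
  rw [rateDeriv₂, threePiece_of_ge (xStar_lt_two hη) le_rfl]
  norm_num

theorem rateFunction_sub_isBigO {η : ℝ} (hη : 0 < η) :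
    (fun x : ℝ => rateFunction η x - (2 - x) ^ 3 / 12) =O[𝓝[<] (2 : ℝ)]
      fun x : ℝ => (2 - x) ^ 4 := by
  have hlt := xStar_lt_two hη
  have h2 : ∀ x ∈ Iic (2 : ℝ), HasDerivAt (fun x => rateDeriv η x + (2 - x) ^ 2 / 4)
      (rateDeriv₂ η x - (2 - x) / 2) x := fun x _ => by
    refine ((hasDerivAt_rateDeriv hη x).add
      ((((hasDerivAt_id x).const_sub 2).pow 2).div_const 4)).congr_deriv ?_
    simp
    ring
  have h1 : ∀ x ∈ Iic (2 : ℝ), HasDerivAt (fun x => rateFunction η x - (2 - x) ^ 3 / 12)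
      (rateDeriv η x + (2 - x) ^ 2 / 4) x := fun x _ => by
    refine ((hasDerivAt_rateFunction hη x).sub
      ((((hasDerivAt_id x).const_sub 2).pow 3).div_const 12)).congr_deriv ?_
    simp
    ring
  have e2 := isBigO_sub_pow_succ ordConnected_Iic self_mem_Iic h2 (rateDeriv₂_sub_isBigO hη)
  have hz1 : rateDeriv η 2 = 0 := threePiece_of_ge hlt le_rfl
  simp only [hz1, sub_self, zero_pow two_ne_zero, zero_div, add_zero, sub_zero] at e2
  have e1 := isBigO_sub_pow_succ ordConnected_Iic self_mem_Iic h1 e2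
  have hz0 : rateFunction η 2 = 0 := by
    rw [rateFunction_eq hη]
    exact threePiece_of_ge hlt le_rfl
  simp only [hz0, sub_self, zero_pow three_ne_zero, zero_div, sub_zero] at e1
  refine (e1.mono (nhdsWithin_mono 2 Iio_subset_Iic_self)).congr_right fun x => ?_
  ring

end PhaseTransition

theorem theorem1p3 (η : ℝ) (hη : 0 < η) :
    -- the objects entering the definition of the rate function are well defined
    (∀ x ∈ Set.Ioo (PhaseTransition.xStar η) 2, ∃! K : ℝ, PhaseTransition.IsHalfPeriod η x K) ∧
    (∀ x ∈ Set.Ioo (PhaseTransition.xStar η) 2,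
      IntervalIntegrable (PhaseTransition.calL η) MeasureTheory.volume
        (PhaseTransition.xStar η) x) ∧
    -- the rate function is `C²` but not `C³` on `ℝ`
    ContDiff ℝ 2 (PhaseTransition.rateFunction η) ∧
    ¬ ContDiff ℝ 3 (PhaseTransition.rateFunction η) ∧
    -- behaviour as `x ↑ 2`
    ((fun x : ℝ => PhaseTransition.rateFunction η x - (2 - x) ^ 3 / 12)
      =O[𝓝[<] (2 : ℝ)] fun x : ℝ => (2 - x) ^ 4) ∧
    -- the second derivative is not Hölder continuous at `x_*`, for any exponent
    (∀ α : ℝ, 0 < α → ¬ ∃ C : ℝ, ∀ᶠ x in 𝓝 (PhaseTransition.xStar η),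
      |iteratedDeriv 2 (PhaseTransition.rateFunction η) x
        - iteratedDeriv 2 (PhaseTransition.rateFunction η) (PhaseTransition.xStar η)|
      ≤ C * |x - PhaseTransition.xStar η| ^ α) := by
  have hholder : ∀ α : ℝ, 0 < α → ¬ ∃ C : ℝ, ∀ᶠ x in 𝓝 (PhaseTransition.xStar η),
      |iteratedDeriv 2 (PhaseTransition.rateFunction η) x
        - iteratedDeriv 2 (PhaseTransition.rateFunction η) (PhaseTransition.xStar η)|
      ≤ C * |x - PhaseTransition.xStar η| ^ α := by
    intro α hα
    rw [PhaseTransition.iteratedDeriv_two_rateFunction hη]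
    exact PhaseTransition.not_holder_rateDeriv₂ hη hα
  refine ⟨fun x hx => PhaseTransition.existsUnique_isHalfPeriod hη hx,
    fun x hx => (PhaseTransition.intervalIntegrable_calL_and_integral hη hx).1,
    PhaseTransition.contDiff_two_rateFunction hη, fun h => hholder 1 one_pos ?_,
    PhaseTransition.rateFunction_sub_isBigO hη, hholder⟩
  -- the second derivative of a `C³` function is Lipschitz at each point
  have hd := (h.differentiable_iteratedDeriv 2 (by norm_num)
    (PhaseTransition.xStar η)).hasDerivAt.isBigO_sub
  obtain ⟨C, hC⟩ := hd.bound
  exact ⟨C, hC.mono fun x hx => by rwa [Real.rpow_one]⟩
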